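/- Let $F$ be $\mathbb{R}$, $\mathbb{C}$ or the quaternions $\mathbb{H}$, let $r\ge 2$ if $F=\mathbb{R}$ and $r\ge 1$ otherwise, and let $$G=\{g\in GL_{r+1}(F): g^*Sg=S\},\qquad S=\begin{pmatrix}0&0&1\\0&1_{r-1}&0\\1&0&0\end{pmatrix},$$ so that $G$ is $O(r,1)$, $U(r,1)$ or $Sp^*(r,1)$. Let $K=\{g\in G: g^*g=1\}$, let $P\subset G$ be the stabilizer of the line spanned by the first basis vector, $N$ its unipotent radical, and $m_y=\mathrm{diag}(y,1_{r-1},1/y)$ for $y>0$; write $g=n\,m_y\,k$ ($n\in N$, $k\in K$) for the Iwasawa decomposition and $y=y(g)$ for the corresponding coordinate. Let $\Gamma\subset G$ be a discrete subgroup with $(N\cap\Gamma)\backslash N$ compact, and let $c>0$ be a height above which the cusp is separated: if $\gamma\in\Gamma$, $g\in G$, $y(g)>c$ and $y(\gamma g)>c$, then $\gamma\in\Gamma\cap P$. (For arithmetic $\Gamma$ of $\mathbb{Q}$-rank one with a cusp at $P$ such a $c$ exists by reduction theory.) Fix a $G$-invariant measure on $\Gamma\backslash G$, finite on compact sets. Let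 $\Delta=2\Omega$, where $\Omega=\sum_i Y_iY_i'$ is the Casimir operator of $\mathfrak{g}=\mathrm{Lie}(G)$, for a basis $Y_i$ of $\mathfrak{g}$ and its dual basis $Y_i'$ with respect to the trace form $\mathrm{Re}\,\mathrm{tr}(XY)$, acting by right differentiation. Let $H^1(\Gamma\backslash G/K)\subset L^2(\Gamma\backslash G/K)$ be the completion of $C_c^\infty(\Gamma\backslash G/K)=C_c^\infty(\Gamma\backslash G)^K$ with respect to the norm $|f|_{H^1}=\langle(1-\Delta)f,f\rangle^{1/2}$. Let $\phi$ be a real function, smooth on $(0,\infty)$, with $0\le\phi\le1$, $\phi(y)=0$ for $0<y\le1$ and $\phi(y)=1$ for $y\ge2$. For $t\ge 1$ with $t\ge c$ and a function $f$ on $\Gamma\backslash G/K$, let $f^{[t]}$ be the smoothly cut-off tail of $f$, that is, the function on $\Gamma\backslash G/K$ with $f^{[t]}(n\,m_y)=\phi(y/t)\,f(n\,m_y)$ in the cusp $\{y>c\}$ and $f^{[t]}=0$ outside of the image of the cusp. Then there is a constant $C$, depending only on $G$ and $\phi$, such that for all $f\in H^1(\Gamma\backslash G/K)$ and all $t\ge1$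 with $t\ge c$ one has $f^{[t]}\in H^1(\Gamma\backslash G/K)$ and $$|f^{[t]}|_{H^1}\le C\,|f|_{H^1}.$$ -/

import Mathlib

open MeasureTheory Filter Topology
open scoped ContDiff Matrix Quaternion

noncomputable section

namespace RankOne

/-- The scalars over which the three families of groups are defined: a normed real algebra with an
involution and a real part `re` such that `re (x * star x) = ‖x‖ ^ 2`.  The only instances used are
`ℝ`, `ℂ` and Hamilton's quaternions `ℍ[ℝ]`, with their usual conjugation and real part. -/
class Scalars (F : Type) [NormedRing F] [StarRing F] [NormedAlgebra ℝ F] where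
  re : F →ₗ[ℝ] ℝ
  re_mul_star : ∀ x : F, re (x * star x) = ‖x‖ ^ 2

instance : Scalars ℝ where
  re := LinearMap.id
  re_mul_star x := by simp [sq]

instance : Scalars ℂ where
  re := Complex.reLm
  re_mul_star x := by
    rw [← Complex.normSq_eq_norm_sq, Complex.normSq_apply]
    simp

instance : Scalars ℍ[ℝ] where
  re :=
    { toFun := fun q => q.re
      map_add' := fun _ _ => rfl
      map_smul' := fun _ _ => rfl }
  re_mul_star x := by
    change (x * star x).re = ‖x‖ ^ 2
    rw [Quaternion.self_mul_star, sq, ← Quaternion.normSq_eq_norm_mul_self]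
    simp

instance : StarModule ℝ ℍ[ℝ] where
  star_smul c x := by
    ext <;> simp

section Group

variable (F : Type) [NormedRing F] [StarRing F] [NormedAlgebra ℝ F] (r : ℕ)

/-- The matrix of the form `S`, with blocks `(0 0 1; 0 1_{r-1} 0; 1 0 0)`, of size `r + 1`. -/
def formS : Matrix (Fin (r + 1)) (Fin (r + 1)) F :=
  Matrix.of fun i j => if j = Equiv.swap 0 (Fin.last r) i then 1 else 0

/-- `G = {g ∈ GL_{r+1}(F) : g* S g = S}`: this is `O(r,1)` for `F = ℝ`, `U(r,1)` for `F = ℂ` and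
`Sp*(r,1)` for `F = ℍ[ℝ]`. -/
def isometryGroup : Subgroup (Matrix (Fin (r + 1)) (Fin (r + 1)) F)ˣ where
  carrier := {g | (g.val)ᴴ * formS F r * g.val = formS F r}
  mul_mem' {a b} ha hb := by
    change (a.val * b.val)ᴴ * formS F r * (a.val * b.val) = formS F r
    change (a.val)ᴴ * formS F r * a.val = formS F r at ha
    change (b.val)ᴴ * formS F r * b.val = formS F r at hb
    rw [Matrix.conjTranspose_mul]
    calc (b.val)ᴴ * (a.val)ᴴ * formS F r * (a.val * b.val)
        = (b.val)ᴴ * ((a.val)ᴴ * formS F r * a.val) * b.val := by simp only [Matrix.mul_assoc]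
      _ = formS F r := by rw [ha, hb]
  one_mem' := by simp
  inv_mem' {a} ha := by
    change (a⁻¹.val)ᴴ * formS F r * a⁻¹.val = formS F r
    change (a.val)ᴴ * formS F r * a.val = formS F r at ha
    have h1 : a.val * a⁻¹.val = 1 := Units.mul_inv a
    have h2 : (a⁻¹.val)ᴴ * (a.val)ᴴ = 1 := by
      rw [← Matrix.conjTranspose_mul, h1, Matrix.conjTranspose_one]
    calc (a⁻¹.val)ᴴ * formS F r * a⁻¹.val
        = (a⁻¹.val)ᴴ * ((a.val)ᴴ * formS F r * a.val) * a⁻¹.val := by rw [ha]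
      _ = ((a⁻¹.val)ᴴ * (a.val)ᴴ) * formS F r * (a.val * a⁻¹.val) := by
          simp only [Matrix.mul_assoc]
      _ = formS F r := by rw [h1, h2, Matrix.one_mul, Matrix.mul_one]

/-- The real Lie group `G`, with the topology of the group of invertible matrices. -/
abbrev Grp : Type := ↥(isometryGroup F r)

variable {F r}

/-- The matrix of an element of `G`. -/
abbrev mat (g : Grp F r) : Matrix (Fin (r + 1)) (Fin (r + 1)) F :=
  ((g : (Matrix (Fin (r + 1)) (Fin (r + 1)) F)ˣ) : Matrix (Fin (r + 1)) (Fin (r + 1)) F)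

/-- Membership in the maximal compact subgroup `K = {g ∈ G : g* g = 1}`. -/
def IsMaxCompact (g : Grp F r) : Prop := (mat g)ᴴ * mat g = 1

/-- Membership in the parabolic subgroup `P`, the stabilizer in `G` of the line spanned by the
first basis vector. -/
def IsParabolic (g : Grp F r) : Prop := ∀ i, i ≠ 0 → mat g i 0 = 0

/-- Membership in the unipotent radical `N` of `P`: the elements of `G` of the block shape
`(1 * *; 0 1_{r-1} *; 0 0 1)`. -/
def IsUnipotent (g : Grp F r) : Prop :=
  ∀ i j, (j = 0 ∨ i = Fin.last r ∨ (i ≠ 0 ∧ j ≠ Fin.last r)) →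
    mat g i j = if i = j then 1 else 0

/-- `g = m_y = diag(y, 1, …, 1, 1/y)`, an element of the split component `A⁺`. -/
def IsSplit (y : ℝ) (g : Grp F r) : Prop :=
  mat g = Matrix.diagonal fun i =>
    if i = 0 then algebraMap ℝ F y else if i = Fin.last r then algebraMap ℝ F y⁻¹ else 1

/-- The Iwasawa coordinate `y` of `g = n m_y k`, as the inverse of the Euclidean norm of the last
row of `g`; see `height_eq`. -/
def height (g : Grp F r) : ℝ := (Real.sqrt (∑ j, ‖mat g (Fin.last r) j‖ ^ 2))⁻¹

/-- The function `height` is the Iwasawa coordinate: it takes the value `y` at `n m_y k`. -/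
theorem height_eq [NormOneClass F] [Scalars F] (hr : 1 ≤ r) {n a k : Grp F r} {y : ℝ} (hy : 0 < y)
    (hn : IsUnipotent n) (ha : IsSplit y a) (hk : IsMaxCompact k) :
    height (n * a * k) = y := by
  have hl : (Fin.last r) ≠ 0 := by
    intro h
    have := congrArg Fin.val h
    simp at this
    omega
  have hk' : mat k * (mat k)ᴴ = 1 := by
    have h2 : mat k * mat k⁻¹ = 1 := by
      have : k * k⁻¹ = 1 := mul_inv_cancel k
      exact congrArg mat this
    have h3 : (mat k)ᴴ = mat k⁻¹ := by
      calc (mat k)ᴴ = (mat k)ᴴ * (mat k * mat k⁻¹) := by rw [h2, Matrix.mul_one]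
        _ = mat k⁻¹ := by rw [← Matrix.mul_assoc, hk, Matrix.one_mul]
    rw [h3, h2]
  have hrow : ∀ j, mat (n * a * k) (Fin.last r) j = y⁻¹ • mat k (Fin.last r) j := by
    intro j
    have h1 : mat (n * a * k) = mat n * mat a * mat k := rfl
    have h2 : ∀ i, mat n (Fin.last r) i = if Fin.last r = i then 1 else 0 :=
      fun i => hn _ _ (Or.inr (Or.inl rfl))
    have h3 : ∀ i, (mat n * mat a) (Fin.last r) i
        = if Fin.last r = i then algebraMap ℝ F y⁻¹ else 0 := by
      intro i
      rw [ha, Matrix.mul_diagonal, h2]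
      by_cases hi : Fin.last r = i
      · subst hi
        simp [hl]
      · simp [hi]
    rw [h1, Matrix.mul_apply]
    simp only [h3, ite_mul, zero_mul, Finset.sum_ite_eq, Finset.mem_univ, if_true]
    rw [Algebra.smul_def]
  have hnorm : ∑ j, ‖mat k (Fin.last r) j‖ ^ 2 = 1 := by
    have h1 : (mat k * (mat k)ᴴ) (Fin.last r) (Fin.last r) = 1 := by rw [hk']; simp
    rw [Matrix.mul_apply] at h1
    simp only [Matrix.conjTranspose_apply] at h1
    have h2 := congrArg (Scalars.re (F := F)) h1
    rw [map_sum] at h2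
    simp only [Scalars.re_mul_star] at h2
    have h3 : Scalars.re (1 : F) = 1 := by
      simpa using Scalars.re_mul_star (1 : F)
    rw [h2, h3]
  unfold height
  simp only [hrow, norm_smul, mul_pow]
  rw [← Finset.mul_sum, hnorm, mul_one, Real.sqrt_sq (norm_nonneg _), norm_inv, inv_inv,
    Real.norm_of_nonneg hy.le]

variable (F r) in
/-- The Lie algebra `𝔤 = {Y : Y* S + S Y = 0}` of `G`, as a real vector space of matrices. -/
def lieAlg [StarModule ℝ F] : Submodule ℝ (Matrix (Fin (r + 1)) (Fin (r + 1)) F) where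
  carrier := {Y | Yᴴ * formS F r + formS F r * Y = 0}
  add_mem' {X Y} hX hY := by
    change Xᴴ * formS F r + formS F r * X = 0 at hX
    change Yᴴ * formS F r + formS F r * Y = 0 at hY
    change (X + Y)ᴴ * formS F r + formS F r * (X + Y) = 0
    rw [Matrix.conjTranspose_add, Matrix.add_mul, Matrix.mul_add, add_add_add_comm, hX, hY,
      add_zero]
  zero_mem' := by simp
  smul_mem' c Y hY := by
    change Yᴴ * formS F r + formS F r * Y = 0 at hY
    change (c • Y)ᴴ * formS F r + formS F r * (c • Y) = 0
    rw [Matrix.conjTranspose_smul, Matrix.smul_mul, Matrix.mul_smul, star_trivial, ← smul_add, hY,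
      smul_zero]

/-- The trace form `B(X, Y) = Re tr(X Y)` on `𝔤`, a multiple of the Killing form. -/
def traceForm [StarModule ℝ F] [Scalars F] : LinearMap.BilinForm ℝ (lieAlg F r) :=
  LinearMap.mk₂ ℝ (fun X Y => Scalars.re (Matrix.trace (X.val * Y.val)))
    (fun X X' Y => by simp [Matrix.add_mul])
    (fun c X Y => by simp)
    (fun X Y Y' => by simp [Matrix.mul_add])
    (fun c X Y => by simp)

theorem formS_mul_self : formS F r * formS F r = 1 := by
  ext i j
  rw [Matrix.mul_apply, Finset.sum_eq_single (Equiv.swap 0 (Fin.last r) i)]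
  · simp [formS, Matrix.one_apply, eq_comm]
  · intro k _ hk
    simp [formS, hk]
  · simp

theorem conjTranspose_mem_lieAlg [StarModule ℝ F] {Y : Matrix (Fin (r + 1)) (Fin (r + 1)) F}
    (hY : Y ∈ lieAlg F r) : Yᴴ ∈ lieAlg F r := by
  change Yᴴ * formS F r + formS F r * Y = 0 at hY
  change Yᴴᴴ * formS F r + formS F r * Yᴴ = 0
  rw [Matrix.conjTranspose_conjTranspose]
  have h : formS F r * (Yᴴ * formS F r + formS F r * Y) * formS F r = 0 := by
    rw [hY, Matrix.mul_zero, Matrix.zero_mul]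
  rw [Matrix.mul_add, Matrix.add_mul] at h
  simp only [← Matrix.mul_assoc] at h
  rw [Matrix.mul_assoc _ (formS F r) (formS F r), formS_mul_self, Matrix.mul_one,
    Matrix.one_mul] at h
  exact (add_comm _ _).trans h

theorem re_trace_mul_conjTranspose [Scalars F] (Y : Matrix (Fin (r + 1)) (Fin (r + 1)) F) :
    Scalars.re (Matrix.trace (Y * Yᴴ)) = ∑ i, ∑ j, ‖Y i j‖ ^ 2 := by
  simp [Matrix.trace, Matrix.mul_apply, Scalars.re_mul_star]

theorem traceForm_nondegenerate [StarModule ℝ F] [Scalars F] :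
    (traceForm (F := F) (r := r)).Nondegenerate := by
  have key : ∀ Y : Matrix (Fin (r + 1)) (Fin (r + 1)) F,
      Scalars.re (Matrix.trace (Y * Yᴴ)) = 0 → Y = 0 := by
    intro Y h
    rw [re_trace_mul_conjTranspose] at h
    ext i j
    have h1 := (Finset.sum_eq_zero_iff_of_nonneg (fun i _ =>
      Finset.sum_nonneg fun j _ => sq_nonneg ‖Y i j‖)).1 h i (Finset.mem_univ i)
    have h2 := (Finset.sum_eq_zero_iff_of_nonneg (fun j _ => sq_nonneg ‖Y i j‖)).1 h1 j
      (Finset.mem_univ j)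
    simpa using h2
  refine ⟨fun X hX => ?_, fun Y hY => ?_⟩
  · exact Subtype.ext (key X.val (hX ⟨X.valᴴ, conjTranspose_mem_lieAlg X.2⟩))
  · have h : Scalars.re (Matrix.trace (Y.valᴴ * Y.valᴴᴴ)) = 0 := by
      rw [Matrix.conjTranspose_conjTranspose]
      exact hY ⟨Y.valᴴ, conjTranspose_mem_lieAlg Y.2⟩
    exact Subtype.ext (Matrix.conjTranspose_eq_zero.1 (key _ h))

/-- The exponential map `𝔤 → G`. -/
def expGrp [StarModule ℝ F] [ContinuousStar F] [FiniteDimensional ℝ F] (Y : lieAlg F r) :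
    Grp F r := by
  letI : NormedAlgebra ℚ F := NormedAlgebra.restrictScalars ℚ ℝ F
  haveI : CompleteSpace F := FiniteDimensional.complete ℝ F
  have h1 : NormedSpace.exp Y.val * NormedSpace.exp (-Y.val) = 1 := by
    rw [← Matrix.exp_add_of_commute _ _ (Commute.neg_right (Commute.refl Y.val)), add_neg_cancel,
      NormedSpace.exp_zero]
  have h2 : NormedSpace.exp (-Y.val) * NormedSpace.exp Y.val = 1 := by
    rw [← Matrix.exp_add_of_commute _ _ (Commute.neg_left (Commute.refl Y.val)), neg_add_cancel,
      NormedSpace.exp_zero]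
  refine ⟨⟨NormedSpace.exp Y.val, NormedSpace.exp (-Y.val), h1, h2⟩, ?_⟩
  change (NormedSpace.exp Y.val)ᴴ * formS F r * NormedSpace.exp Y.val = formS F r
  have hY : Y.valᴴ * formS F r + formS F r * Y.val = 0 := Y.2
  let U : (Matrix (Fin (r + 1)) (Fin (r + 1)) F)ˣ :=
    ⟨formS F r, formS F r, formS_mul_self, formS_mul_self⟩
  have h3 : Y.valᴴ = U.val * (-Y.val) * U⁻¹.val := by
    change Y.valᴴ = formS F r * (-Y.val) * formS F r
    rw [Matrix.mul_neg, ← eq_neg_of_add_eq_zero_left hY, Matrix.mul_assoc, formS_mul_self,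
      Matrix.mul_one]
  have h4 : (NormedSpace.exp Y.val)ᴴ = formS F r * NormedSpace.exp (-Y.val) * formS F r := by
    rw [← Matrix.exp_conjTranspose, h3]
    exact Matrix.exp_units_conj U (-Y.val)
  rw [h4, Matrix.mul_assoc _ (formS F r) (formS F r), formS_mul_self, Matrix.mul_one,
    Matrix.mul_assoc, h2, Matrix.mul_one]

theorem mat_expGrp [StarModule ℝ F] [ContinuousStar F] [FiniteDimensional ℝ F]
    (Y : lieAlg F r) : mat (expGrp Y) = NormedSpace.exp Y.val := rfl

/-- The quotient `Γ\G`: the space of right cosets `Γ g`. -/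
def Quo (Γ : Subgroup (Grp F r)) : Type := Quotient (MulAction.orbitRel Γ (Grp F r))

instance (Γ : Subgroup (Grp F r)) : TopologicalSpace (Quo Γ) :=
  inferInstanceAs (TopologicalSpace (Quotient (MulAction.orbitRel Γ (Grp F r))))

instance (Γ : Subgroup (Grp F r)) : MeasurableSpace (Quo Γ) := borel _

instance (Γ : Subgroup (Grp F r)) : BorelSpace (Quo Γ) := ⟨rfl⟩

/-- The coset `Γ g`. -/
def Quo.mk (Γ : Subgroup (Grp F r)) (g : Grp F r) : Quo Γ :=
  Quotient.mk (MulAction.orbitRel Γ (Grp F r)) g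

/-- Right translation `Γ g ↦ Γ g h` on `Γ\G`. -/
def Quo.rmul {Γ : Subgroup (Grp F r)} (x : Quo Γ) (h : Grp F r) : Quo Γ :=
  Quotient.map (sa := MulAction.orbitRel Γ (Grp F r)) (sb := MulAction.orbitRel Γ (Grp F r))
    (fun g => g * h)
    (by
      rintro a b ⟨γ, rfl⟩
      exact ⟨γ, (mul_assoc (γ : Grp F r) b h).symm⟩) x

/-- A complex function on `Γ\G` is smooth if its lift to `G` is, locally, the restriction of a
smooth function on the space of matrices. -/
def SmoothFun {Γ : Subgroup (Grp F r)} (u : Quo Γ → ℂ) : Prop :=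
  ∀ g : Grp F r, ∃ (U : Set (Fin (r + 1) → Fin (r + 1) → F))
    (Φ : (Fin (r + 1) → Fin (r + 1) → F) → ℂ), IsOpen U ∧ (fun i j => mat g i j) ∈ U ∧
      ContDiffOn ℝ ∞ Φ U ∧
      ∀ h : Grp F r, (fun i j => mat h i j) ∈ U → u (Quo.mk Γ h) = Φ (fun i j => mat h i j)

/-- Right `K`-invariance of a function on `Γ\G`; such functions are the functions on `Γ\G/K`. -/
def KInvariant {Γ : Subgroup (Grp F r)} (u : Quo Γ → ℂ) : Prop :=
  ∀ (x : Quo Γ) (k : Grp F r), IsMaxCompact k → u (x.rmul k) = u x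

/-- The space `C_c^∞(Γ\G/K)` of right `K`-invariant functions in `C_c^∞(Γ\G)`. -/
def IsTestFun {Γ : Subgroup (Grp F r)} (u : Quo Γ → ℂ) : Prop :=
  SmoothFun u ∧ HasCompactSupport u ∧ KInvariant u

/-- The action of `Y ∈ 𝔤` on functions on `Γ\G` by
`(Y u)(x) = d/ds u(x exp(s Y))` at `s = 0`. -/
def lieDeriv [StarModule ℝ F] [ContinuousStar F] [FiniteDimensional ℝ F]
    {Γ : Subgroup (Grp F r)} (Y : lieAlg F r) (u : Quo Γ → ℂ) : Quo Γ → ℂ :=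
  fun x => deriv (fun s : ℝ => u (x.rmul (expGrp (s • Y)))) 0

variable [StarModule ℝ F] [ContinuousStar F] [FiniteDimensional ℝ F] [Scalars F]

/-- The Casimir operator `Ω = ∑ Yᵢ Yᵢ'`, for a basis `Yᵢ` of `𝔤` and the dual basis `Yᵢ'` with
respect to the trace form (the operator does not depend on the basis). -/
def casimir {Γ : Subgroup (Grp F r)} (u : Quo Γ → ℂ) : Quo Γ → ℂ :=
  fun x => ∑ i, lieDeriv (Module.finBasis ℝ (lieAlg F r) i)
    (lieDeriv (traceForm.dualBasis traceForm_nondegenerate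
      (Module.finBasis ℝ (lieAlg F r)) i) u) x

/-- The Laplacian `Δ` of `Γ\G/K`: the Casimir operator, normalized so that its leading term in the
Iwasawa coordinate `y` is `y² ∂²/∂y²`. -/
def laplacian {Γ : Subgroup (Grp F r)} (u : Quo Γ → ℂ) : Quo Γ → ℂ :=
  fun x => 2 * casimir u x

/-- The norm `|u| = ⟨(1 - Δ) u, u⟩^{1/2}` on test functions. -/
def testNorm {Γ : Subgroup (Grp F r)} (ν : Measure (Quo Γ)) (u : Quo Γ → ℂ) : ℝ :=
  Real.sqrt (∫ x, (u x - laplacian u x) * (starRingEnd ℂ) (u x) ∂ν).re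

/-- `f ∈ L²(Γ\G/K)` is the element of `H¹(Γ\G/K)` given by a sequence of test functions that is
Cauchy for the `H¹`-norm and converges to `f` in `L²`, and `a` is the limit of their norms. -/
def HasH1Norm {Γ : Subgroup (Grp F r)} (ν : Measure (Quo Γ)) (f : Quo Γ → ℂ) (a : ℝ) : Prop :=
  MemLp f 2 ν ∧ KInvariant f ∧ ∃ u : ℕ → Quo Γ → ℂ,
    (∀ n, IsTestFun (u n)) ∧
    (∀ ε > 0, ∃ N, ∀ m ≥ N, ∀ n ≥ N, testNorm ν (u m - u n) < ε) ∧
    Tendsto (fun n => eLpNorm (u n - f) 2 ν) atTop (𝓝 0) ∧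
    Tendsto (fun n => testNorm ν (u n)) atTop (𝓝 a)

/-- Membership in `H¹(Γ\G/K)`, the completion of `C_c^∞(Γ\G/K)` for the norm
`⟨(1 - Δ) u, u⟩^{1/2}`, realized inside `L²(Γ\G/K)`. -/
def MemH1 {Γ : Subgroup (Grp F r)} (ν : Measure (Quo Γ)) (f : Quo Γ → ℂ) : Prop :=
  ∃ a, HasH1Norm ν f a

/-- The norm of an element `f` of `H¹(Γ\G/K)`: the (only) number `a` with `HasH1Norm ν f a`. -/
def h1Norm {Γ : Subgroup (Grp F r)} (ν : Measure (Quo Γ)) (f : Quo Γ → ℂ) : ℝ :=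
  sInf {a | HasH1Norm ν f a}

/-- `ν` is a `G`-invariant measure on `Γ\G`, finite on compact sets. -/
structure IsInvariantMeasure {Γ : Subgroup (Grp F r)} (ν : Measure (Quo Γ)) : Prop where
  finite_of_isCompact : ∀ C : Set (Quo Γ), IsCompact C → ν C < ⊤
  map_rmul : ∀ h : Grp F r, ν.map (fun x => x.rmul h) = ν

/-- `(N ∩ Γ)\N` is compact. -/
def UnipotentCocompact (Γ : Subgroup (Grp F r)) : Prop :=
  ∃ C : Set (Grp F r), IsCompact C ∧
    ∀ n : Grp F r, IsUnipotent n → ∃ γ ∈ Γ, IsUnipotent γ ∧ γ * n ∈ C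

/-- Above the height `c > 0` the cusp is separated: `γ {y > c}` meets `{y > c}` only for
`γ ∈ Γ ∩ P`. -/
def IsCuspHeight (Γ : Subgroup (Grp F r)) (c : ℝ) : Prop :=
  0 < c ∧ ∀ γ ∈ Γ, ∀ g : Grp F r, c < height g → c < height (γ * g) → IsParabolic γ

/-- A smooth step `φ` on `(0, ∞)`, with `φ = 0` on `(0, 1]`, `0 ≤ φ ≤ 1`, and `φ = 1` on
`[2, ∞)`. -/
structure IsSmoothStep (φ : ℝ → ℝ) : Prop where
  contDiffOn : ContDiffOn ℝ ∞ φ (Set.Ioi 0)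
  eq_zero : ∀ y, 0 < y → y ≤ 1 → φ y = 0
  mem_Icc : ∀ y, 0 < y → φ y ∈ Set.Icc 0 1
  eq_one : ∀ y, 2 ≤ y → φ y = 1

open Classical in
/-- The smoothly cut-off tail `f^{[t]}`: at `x = Γ g` with `g = n m_y k` in the cusp it takes the
value `φ(y / t) f(x)`, and it vanishes outside of the cusp.  Since `φ(y / t) = 0` for `y ≤ t`, only
representatives `g` with `y > t` matter; when `t` is at least a height above which the cusp is
separated, they all have the same coordinate `y`. -/
def cuspTail {Γ : Subgroup (Grp F r)} (φ : ℝ → ℝ) (t : ℝ) (f : Quo Γ → ℂ) : Quo Γ → ℂ :=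
  fun x =>
    if h : ∃ g : Grp F r, Quo.mk Γ g = x ∧ t < height g then
      (φ (height h.choose / t) : ℂ) * f x
    else 0

variable (F r) in
/-- The bound `|f^{[t]}|_{H¹} ≤ C |f|_{H¹}` for the group `G` over `F`, where `C` depends only on the
group and on the smooth step `φ`; the element `f^{[t]}` is asserted to lie in `H¹`. -/
def TailBound : Prop :=
  ∀ φ : ℝ → ℝ, IsSmoothStep φ → ∃ C : ℝ,
    ∀ (Γ : Subgroup (Grp F r)), DiscreteTopology Γ → UnipotentCocompact Γ →
    ∀ ν : Measure (Quo Γ), IsInvariantMeasure ν →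
    ∀ c : ℝ, IsCuspHeight Γ c →
    ∀ f : Quo Γ → ℂ, MemH1 ν f →
    ∀ t : ℝ, 1 ≤ t → c ≤ t →
      MemH1 ν (cuspTail φ t f) ∧ h1Norm ν (cuspTail φ t f) ≤ C * h1Norm ν f

end Group

end RankOne

end

set_option linter.unusedSectionVars false

noncomputable section

namespace RankOne

/-! The tail is a product `ψ f`, where `ψ` equals `φ(y/t)` in the cusp and `0` elsewhere. It
therefore suffices that `ψ` is a smooth right `K`-invariant function on `Γ\G` with values in `[0,1]`
and with a gradient bounded in terms of `G` and `φ` alone. Multiplication by such a function is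
bounded on `H¹`.

Multipliers. Right translations preserve the measure, so derivatives of compactly supported
functions integrate to zero, and Green's formula (`testNorm_eq`) turns `⟨(1 - Δ)u, u⟩` into the
integral of `|u|² + 2 E(du)`, with `E` the form dual to the trace form. `E` is indefinite on all
covectors, but the differential of a `K`-invariant function kills the skew-Hermitian part of the Lie
algebra, and there `E ≥ 0` (`energy_nonneg`). The Leibniz rule and the parallelogram law then bound
`E(d(ψu))` by `2|ψ|²E(du) + 2|u|²E(dψ)` (`testNorm_mul_le`), and a limit gives the statement on `H¹`
(`hasH1Norm_mul`).

Well-definedness. Two representatives of a point above height `t ≥ c` differ by some `p` in `Γ ∩ P`,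
and such a `p` preserves `y`. Otherwise `p` or its inverse contracts `N`, and conjugating a
nontrivial unipotent element of `Γ` by its powers gives elements of `Γ` tending to `1`, against
discreteness (`norm_parabolic_last_eq_one`). Such a unipotent element exists because `N` is not
compact while `(N ∩ Γ)\N` is; this is where `r ≥ 2` enters for `ℝ`.

Smoothness. Near a point only finitely many horoballs `y(γg) > t` matter, up to `Γ ∩ P`. Infinitely
many would give bounded last rows of `γg` accumulating at an isotropic vector. Some `b` in `G`
shrinks that vector, which lifts many `γgb` above `c` at once, against separation
(`exists_equivalent`). So `ψ` is locally a finite sum of functions `φ(y(γh)/t)`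
(`smoothFun_cuspWeight`).

Gradient. Since `y⁻²` is the squared length of the last row, on which `G` acts linearly from the
right, `Y log y` is bounded on all of `G`. As `φ'(a)a` is bounded too, the derivative of `φ(y/t)` is
bounded uniformly in `t` (`norm_lieDeriv_cuspWeight_le`). -/

/-- Scalars for which `x * star x` is the real number `‖x‖ ^ 2`. -/
class CompositionScalars (F : Type) [NormedRing F] [StarRing F] [NormedAlgebra ℝ F] : Prop where
  mul_star_self : ∀ x : F, x * star x = algebraMap ℝ F (‖x‖ ^ 2)

instance : CompositionScalars ℝ where
  mul_star_self x := by simp [sq]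

instance : CompositionScalars ℂ where
  mul_star_self x := by
    change x * (starRingEnd ℂ) x = _
    rw [Complex.mul_conj, Complex.normSq_eq_norm_sq]
    simp

instance : CompositionScalars ℍ[ℝ] where
  mul_star_self x := by
    rw [Quaternion.self_mul_star, sq, ← Quaternion.normSq_eq_norm_mul_self]
    rfl

/-! ### Matrix identities in `G`, the height, and parabolic elements. -/

section Algebra

variable {F : Type} [NormedRing F] [StarRing F] [NormedAlgebra ℝ F] {r : ℕ}

theorem mat_mul (g h : Grp F r) : mat (g * h) = mat g * mat h := rfl

theorem mat_one : mat (1 : Grp F r) = 1 := rfl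

theorem mat_mul_inv (g : Grp F r) : mat g * mat g⁻¹ = 1 := by
  rw [← mat_mul, mul_inv_cancel, mat_one]

theorem mat_inv_mul (g : Grp F r) : mat g⁻¹ * mat g = 1 := by
  rw [← mat_mul, inv_mul_cancel, mat_one]

theorem conjTranspose_formS_mul (g : Grp F r) :
    (mat g)ᴴ * formS F r * mat g = formS F r := g.2

theorem mat_inv (g : Grp F r) : mat g⁻¹ = formS F r * (mat g)ᴴ * formS F r := by
  calc mat g⁻¹ = formS F r * formS F r * mat g⁻¹ := by rw [formS_mul_self, Matrix.one_mul]
    _ = formS F r * ((mat g)ᴴ * formS F r * mat g) * mat g⁻¹ := by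
      rw [conjTranspose_formS_mul]
    _ = formS F r * (mat g)ᴴ * formS F r * (mat g * mat g⁻¹) := by
      simp only [Matrix.mul_assoc]
    _ = _ := by rw [mat_mul_inv, Matrix.mul_one]

theorem formS_mul_apply (A : Matrix (Fin (r + 1)) (Fin (r + 1)) F) (i j : Fin (r + 1)) :
    (formS F r * A) i j = A (Equiv.swap 0 (Fin.last r) i) j := by
  rw [Matrix.mul_apply, Finset.sum_eq_single (Equiv.swap 0 (Fin.last r) i)]
  · simp [formS]
  · intro k _ hk
    simp [formS, hk]
  · simp

theorem mul_formS_apply (A : Matrix (Fin (r + 1)) (Fin (r + 1)) F) (i j : Fin (r + 1)) :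
    (A * formS F r) i j = A i (Equiv.swap 0 (Fin.last r) j) := by
  rw [Matrix.mul_apply, Finset.sum_eq_single (Equiv.swap 0 (Fin.last r) j)]
  · simp [formS]
  · intro k _ hk
    have : j ≠ Equiv.swap 0 (Fin.last r) k := fun h => hk (by rw [h, Equiv.swap_apply_self])
    simp [formS, this]
  · simp

theorem formS_conjTranspose : (formS F r)ᴴ = formS F r := by
  ext i j
  have : (i = Equiv.swap 0 (Fin.last r) j) ↔ (j = Equiv.swap 0 (Fin.last r) i) := by
    constructor <;> · rintro h; rw [h, Equiv.swap_apply_self]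
  simp only [formS, Matrix.conjTranspose_apply, Matrix.of_apply, this]
  split_ifs <;> simp

theorem mul_formS_conjTranspose (g : Grp F r) :
    mat g * formS F r * (mat g)ᴴ = formS F r := by
  have h : mat g * (formS F r * (mat g)ᴴ * formS F r) = 1 := by
    rw [← mat_inv, mat_mul_inv]
  calc mat g * formS F r * (mat g)ᴴ
      = mat g * (formS F r * (mat g)ᴴ * formS F r) * formS F r := by
        simp only [Matrix.mul_assoc, formS_mul_self, Matrix.mul_one]
    _ = formS F r := by rw [h, Matrix.one_mul]

theorem mat_inv_apply (g : Grp F r) (i j : Fin (r + 1)) :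
    mat g⁻¹ i j
      = star (mat g (Equiv.swap 0 (Fin.last r) j) (Equiv.swap 0 (Fin.last r) i)) := by
  rw [mat_inv, mul_formS_apply, formS_mul_apply, Matrix.conjTranspose_apply]

theorem mat_injective : Function.Injective (mat : Grp F r → _) := fun _ _ h =>
  Subtype.ext (Units.ext h)

/-- The element of `G` with a given matrix preserving the form. -/
def ofMatrix (A : Matrix (Fin (r + 1)) (Fin (r + 1)) F)
    (h1 : Aᴴ * formS F r * A = formS F r) (h2 : A * formS F r * Aᴴ = formS F r) : Grp F r :=
  ⟨⟨A, formS F r * Aᴴ * formS F r,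
    by rw [← Matrix.mul_assoc, ← Matrix.mul_assoc, h2, formS_mul_self],
    by rw [Matrix.mul_assoc, Matrix.mul_assoc, ← Matrix.mul_assoc Aᴴ, h1, formS_mul_self]⟩, h1⟩

theorem mat_ofMatrix (A : Matrix (Fin (r + 1)) (Fin (r + 1)) F)
    (h1 : Aᴴ * formS F r * A = formS F r) (h2 : A * formS F r * Aᴴ = formS F r) :
    mat (ofMatrix A h1 h2) = A := rfl

theorem expGrp_smul_add [StarModule ℝ F] [ContinuousStar F] [FiniteDimensional ℝ F]
    (Y : lieAlg F r) (s s' : ℝ) :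
    expGrp ((s + s') • Y) = expGrp (s • Y) * expGrp (s' • Y) := by
  let : NormedAlgebra ℚ F := NormedAlgebra.restrictScalars ℚ ℝ F
  have : CompleteSpace F := FiniteDimensional.complete ℝ F
  apply mat_injective
  rw [mat_mul, mat_expGrp, mat_expGrp, mat_expGrp, add_smul]
  exact Matrix.exp_add_of_commute _ _
    (((Commute.refl Y.val).smul_left s).smul_right s')

theorem expGrp_zero [StarModule ℝ F] [ContinuousStar F] [FiniteDimensional ℝ F] :
    expGrp (0 : lieAlg F r) = 1 :=
  mat_injective (by rw [mat_expGrp, mat_one]; exact NormedSpace.exp_zero)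

/-! ### The last row -/

/-- The squared Euclidean norm of the last row of a matrix. -/
def rowSq (A : Matrix (Fin (r + 1)) (Fin (r + 1)) F) : ℝ := ∑ j, ‖A (Fin.last r) j‖ ^ 2

theorem height_def (g : Grp F r) : height g = (Real.sqrt (rowSq (mat g)))⁻¹ := rfl

theorem rowSq_nonneg (A : Matrix (Fin (r + 1)) (Fin (r + 1)) F) : 0 ≤ rowSq A :=
  Finset.sum_nonneg fun _ _ => sq_nonneg _

theorem rowSq_mat_pos [NormOneClass F] (g : Grp F r) : 0 < rowSq (mat g) := by
  refine lt_of_le_of_ne (rowSq_nonneg _) fun h => ?_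
  have h1 := (Finset.sum_eq_zero_iff_of_nonneg (fun j _ => sq_nonneg _)).1 h.symm
  have h2 : (mat g * mat g⁻¹) (Fin.last r) (Fin.last r) = 0 := by
    rw [Matrix.mul_apply]
    refine Finset.sum_eq_zero fun j hj => ?_
    rw [norm_eq_zero.1 (pow_eq_zero_iff two_ne_zero |>.1 (h1 j hj)), zero_mul]
  rw [mat_mul_inv, Matrix.one_apply_eq] at h2
  have : Nontrivial F := NormOneClass.nontrivial
  exact one_ne_zero h2

theorem height_pos [NormOneClass F] (g : Grp F r) : 0 < height g :=
  inv_pos.2 (Real.sqrt_pos.2 (rowSq_mat_pos g))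

theorem lt_height_iff [NormOneClass F] {a : ℝ} (ha : 0 < a) (g : Grp F r) :
    a < height g ↔ rowSq (mat g) < (a⁻¹) ^ 2 := by
  rw [height_def, lt_inv_comm₀ ha (Real.sqrt_pos.2 (rowSq_mat_pos g)),
    Real.sqrt_lt' (inv_pos.2 ha)]

/-- Cauchy–Schwarz. It compares the heights of `g` and `gh` when `h` stays bounded. -/
theorem rowSq_mul_le (A B : Matrix (Fin (r + 1)) (Fin (r + 1)) F) :
    rowSq (A * B) ≤ rowSq A * ∑ j, ∑ i, ‖B i j‖ ^ 2 := by
  rw [rowSq, Finset.mul_sum]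
  refine Finset.sum_le_sum fun j _ => ?_
  refine le_trans ?_ (Finset.sum_mul_sq_le_sq_mul_sq _ _ _)
  rw [Matrix.mul_apply]
  gcongr
  exact (norm_sum_le _ _).trans (Finset.sum_le_sum fun i _ => norm_mul_le _ _)

theorem rowSq_eq_re [NormOneClass F] [Scalars F] (A : Matrix (Fin (r + 1)) (Fin (r + 1)) F) :
    rowSq A = Scalars.re ((A * Aᴴ) (Fin.last r) (Fin.last r)) := by
  rw [Matrix.mul_apply, map_sum]
  simp only [Matrix.conjTranspose_apply, Scalars.re_mul_star]
  rfl

theorem isMaxCompact_mul_conjTranspose {k : Grp F r} (hk : IsMaxCompact k) :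
    mat k * (mat k)ᴴ = 1 := by
  have h3 : (mat k)ᴴ = mat k⁻¹ := by
    calc (mat k)ᴴ = (mat k)ᴴ * (mat k * mat k⁻¹) := by rw [mat_mul_inv, Matrix.mul_one]
      _ = mat k⁻¹ := by rw [← Matrix.mul_assoc, hk, Matrix.one_mul]
  rw [h3, mat_mul_inv]

/-- `rowSq` is the last diagonal entry of `A A*`, and `(gk)(gk)* = g g*`. -/
theorem height_mul_isMaxCompact [NormOneClass F] [Scalars F] (g : Grp F r) {k : Grp F r}
    (hk : IsMaxCompact k) : height (g * k) = height g := by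
  rw [height_def, height_def, rowSq_eq_re, rowSq_eq_re, mat_mul, Matrix.conjTranspose_mul,
    Matrix.mul_assoc, ← Matrix.mul_assoc (mat k), isMaxCompact_mul_conjTranspose hk,
    Matrix.one_mul]

/-! ### Parabolic elements -/

theorem isParabolic_apply_zero {p : Grp F r} (hp : IsParabolic p) :
    mat p⁻¹ 0 0 * mat p 0 0 = 1 := by
  have h : (mat p⁻¹ * mat p) 0 0 = 1 := by rw [mat_inv_mul, Matrix.one_apply_eq]
  rw [Matrix.mul_apply, Finset.sum_eq_single 0] at h
  · exact h
  · intro i _ hi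
    rw [hp i hi, mul_zero]
  · simp

variable [NormOneClass F] [NormMulClass F]

theorem isParabolic_inv {p : Grp F r} (hp : IsParabolic p) : IsParabolic p⁻¹ := by
  intro i hi
  have h : (mat p⁻¹ * mat p) i 0 = 0 := by rw [mat_inv_mul, Matrix.one_apply_ne hi]
  rw [Matrix.mul_apply, Finset.sum_eq_single 0] at h
  · have : Nontrivial F := NormOneClass.nontrivial
    have h0 : mat p 0 0 ≠ 0 := fun h0 => by
      have := isParabolic_apply_zero hp
      rw [h0, mul_zero] at this
      exact zero_ne_one this
    rw [← norm_eq_zero, norm_mul, mul_eq_zero] at h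
    exact norm_eq_zero.1 (h.resolve_right (norm_ne_zero_iff.2 h0))
  · intro j _ hj
    rw [hp j hj, mul_zero]
  · simp

/-- An isometry fixing the isotropic line of the first basis vector also preserves its orthogonal
hyperplane, which consists of the vectors with last coordinate zero. -/
theorem isParabolic_last {p : Grp F r} (hp : IsParabolic p) {j : Fin (r + 1)}
    (hj : j ≠ Fin.last r) : mat p (Fin.last r) j = 0 := by
  have h : mat p⁻¹ (Equiv.swap 0 (Fin.last r) j) 0 = 0 := by
    refine isParabolic_inv hp _ fun h => hj ?_
    rw [Equiv.swap_apply_eq_iff] at h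
    simpa using h
  rw [mat_inv_apply, Equiv.swap_apply_left, Equiv.swap_apply_self] at h
  exact star_eq_zero.1 h

theorem isParabolic_mul {p q : Grp F r} (hp : IsParabolic p) (hq : IsParabolic q) :
    IsParabolic (p * q) := by
  intro i hi
  rw [mat_mul, Matrix.mul_apply]
  refine Finset.sum_eq_zero fun j _ => ?_
  by_cases hj : j = 0
  · rw [hj, hp i hi, zero_mul]
  · rw [hq j hj, mul_zero]

theorem isParabolic_mul_last {p : Grp F r} (hp : IsParabolic p)
    (A : Matrix (Fin (r + 1)) (Fin (r + 1)) F) (j : Fin (r + 1)) :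
    (mat p * A) (Fin.last r) j = mat p (Fin.last r) (Fin.last r) * A (Fin.last r) j := by
  rw [Matrix.mul_apply, Finset.sum_eq_single (Fin.last r)]
  · intro i _ hi
    rw [isParabolic_last hp hi, zero_mul]
  · simp

theorem height_parabolic_mul {p : Grp F r} (hp : IsParabolic p) (g : Grp F r) :
    height (p * g) = ‖mat p (Fin.last r) (Fin.last r)‖⁻¹ * height g := by
  rw [height_def, height_def, mat_mul, rowSq]
  simp only [isParabolic_mul_last hp, norm_mul, mul_pow]
  rw [← Finset.mul_sum, Real.sqrt_mul (sq_nonneg _), Real.sqrt_sq (norm_nonneg _), mul_inv]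
  rfl

theorem norm_isParabolic_inv_last {p : Grp F r} (hp : IsParabolic p) :
    ‖mat p (Fin.last r) (Fin.last r)‖ * ‖mat p⁻¹ (Fin.last r) (Fin.last r)‖ = 1 := by
  rw [← norm_mul, ← isParabolic_mul_last hp, mat_mul_inv, Matrix.one_apply_eq, norm_one]

/-- The two corner entries are linked by the form: the `(0,0)` entry of `p⁻¹` is the conjugate of
the last diagonal entry of `p`. -/
theorem norm_isParabolic_zero_last [NormedStarGroup F] {p : Grp F r} (hp : IsParabolic p) :
    ‖mat p (Fin.last r) (Fin.last r)‖ * ‖mat p 0 0‖ = 1 := by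
  have h := congrArg norm (isParabolic_apply_zero hp)
  rwa [mat_inv_apply, Equiv.swap_apply_left, norm_mul, norm_star, norm_one] at h

end Algebra

/-! ### Entrywise topology of `G`, and contraction of `N` by parabolic elements. -/

section Discrete

variable {F : Type} [NormedRing F] [StarRing F] [NormedAlgebra ℝ F] [ContinuousStar F] {r : ℕ}

theorem continuous_mat : Continuous (mat : Grp F r → _) :=
  Units.continuous_val.comp continuous_subtype_val

/-- The inverse of `A` in `G` is `S A* S`, a continuous function of `A`, so the second component of
the unit topology adds nothing. -/
theorem isInducing_mat : IsInducing (mat : Grp F r → _) := by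
  let Ψ : Matrix (Fin (r + 1)) (Fin (r + 1)) F →
      Matrix (Fin (r + 1)) (Fin (r + 1)) F × (Matrix (Fin (r + 1)) (Fin (r + 1)) F)ᵐᵒᵖ :=
    fun A => (A, MulOpposite.op (formS F r * Aᴴ * formS F r))
  have hΨ : Continuous Ψ := by
    refine continuous_id.prodMk (MulOpposite.continuous_op.comp ?_)
    fun_prop
  refine IsInducing.of_comp continuous_mat hΨ ?_
  have h : Ψ ∘ (mat : Grp F r → _) = Units.embedProduct _ ∘ Subtype.val := by
    funext g
    exact Prod.ext rfl (congrArg MulOpposite.op (mat_inv g).symm)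
  rw [h]
  exact (Units.isEmbedding_embedProduct.isInducing).comp IsInducing.subtypeVal

theorem tendsto_iff_mat {ι : Type*} {l : Filter ι} {x : ι → Grp F r} {g : Grp F r} :
    Tendsto x l (𝓝 g) ↔ ∀ i j, Tendsto (fun n => mat (x n) i j) l (𝓝 (mat g i j)) := by
  rw [isInducing_mat.tendsto_nhds_iff]
  exact tendsto_pi_nhds.trans (forall_congr' fun i => tendsto_pi_nhds)

/-! ### Conjugation of unipotent elements by parabolic elements -/

/-- `p⁻¹qp - 1 = p⁻¹(q - 1)p`, and `p` is block upper triangular, so the vanishing pattern of `q -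
1` survives. -/
theorem isUnipotent_conj [NormOneClass F] [NormMulClass F] {p q : Grp F r} (hp : IsParabolic p)
    (hq : IsUnipotent q) : IsUnipotent (p⁻¹ * q * p) := by
  have h0 : mat (p⁻¹ * q * p) = 1 + mat p⁻¹ * (mat q - 1) * mat p := by
    rw [Matrix.mul_sub, Matrix.sub_mul, Matrix.mul_one, mat_inv_mul, mat_mul, mat_mul]
    abel
  have hz : ∀ i j, (j = 0 ∨ i = Fin.last r ∨ (i ≠ 0 ∧ j ≠ Fin.last r)) →
      (mat q - 1) i j = 0 := by
    intro i j h
    rw [Matrix.sub_apply, hq i j h, Matrix.one_apply, sub_self]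
  intro i j h
  have h1 : (mat p⁻¹ * (mat q - 1) * mat p) i j = 0 := by
    simp only [Matrix.mul_apply, Finset.sum_mul]
    refine Finset.sum_eq_zero fun l _ => Finset.sum_eq_zero fun k _ => ?_
    rcases h with rfl | rfl | ⟨hi, hj⟩
    · by_cases hl : l = 0
      · rw [hz k l (Or.inl hl), mul_zero, zero_mul]
      · rw [hp l hl, mul_zero]
    · by_cases hk : k = Fin.last r
      · rw [hz k l (Or.inr (Or.inl hk)), mul_zero, zero_mul]
      · rw [isParabolic_last (isParabolic_inv hp) hk, zero_mul, zero_mul]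
    · by_cases hk : k = 0
      · rw [hk, isParabolic_inv hp i hi, zero_mul, zero_mul]
      · by_cases hl : l = Fin.last r
        · rw [hl, isParabolic_last hp hj, mul_zero]
        · rw [hz k l (Or.inr (Or.inr ⟨hk, hl⟩)), mul_zero, zero_mul]
  rw [h0, Matrix.add_apply, h1, add_zero, Matrix.one_apply]

/-- The squared norm of the middle coordinates of a vector. -/
def midSq (x : Fin (r + 1) → F) : ℝ :=
  ∑ i, if i = 0 ∨ i = Fin.last r then 0 else ‖x i‖ ^ 2

theorem midSq_nonneg (x : Fin (r + 1) → F) : 0 ≤ midSq x :=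
  Finset.sum_nonneg fun i _ => by split_ifs <;> positivity

theorem norm_le_sqrt_midSq (x : Fin (r + 1) → F) {i : Fin (r + 1)} (h0 : i ≠ 0)
    (hl : i ≠ Fin.last r) : ‖x i‖ ≤ Real.sqrt (midSq x) := by
  refine Real.le_sqrt_of_sq_le ?_
  have := Finset.single_le_sum (f := fun i => if i = 0 ∨ i = Fin.last r then 0 else ‖x i‖ ^ 2)
    (fun i _ => by split_ifs <;> positivity) (Finset.mem_univ i)
  simpa [midSq, h0, hl] using this

variable [NormOneClass F] [NormMulClass F] [NormedStarGroup F] [CompositionScalars F]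

theorem star_mul_self_eq (x : F) : star x * x = algebraMap ℝ F (‖x‖ ^ 2) := by
  simpa using CompositionScalars.mul_star_self (star x)

theorem form_eq_midSq {x : Fin (r + 1) → F} (hx : x (Fin.last r) = 0) :
    star x ⬝ᵥ (formS F r *ᵥ x) = algebraMap ℝ F (midSq x) := by
  rw [midSq, map_sum, dotProduct]
  refine Finset.sum_congr rfl fun i _ => ?_
  have h1 : (formS F r *ᵥ x) i = x (Equiv.swap 0 (Fin.last r) i) := by
    rw [Matrix.mulVec, dotProduct, Finset.sum_eq_single (Equiv.swap 0 (Fin.last r) i)]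
    · simp [formS]
    · intro k _ hk
      simp [formS, hk]
    · simp
  rw [h1, Pi.star_apply]
  by_cases h0 : i = 0
  · simp [h0, hx]
  · by_cases hl : i = Fin.last r
    · simp [hl, hx]
    · rw [Equiv.swap_apply_of_ne_of_ne h0 hl, star_mul_self_eq]
      simp [h0, hl]

theorem form_mulVec (p : Grp F r) (x : Fin (r + 1) → F) :
    star (mat p *ᵥ x) ⬝ᵥ (formS F r *ᵥ (mat p *ᵥ x)) = star x ⬝ᵥ (formS F r *ᵥ x) := by
  rw [Matrix.star_mulVec, ← Matrix.dotProduct_mulVec, Matrix.mulVec_mulVec, Matrix.mulVec_mulVec,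
    conjTranspose_formS_mul]

theorem midSq_mulVec {p : Grp F r} (hp : IsParabolic p) {x : Fin (r + 1) → F}
    (hx : x (Fin.last r) = 0) : midSq (mat p *ᵥ x) = midSq x := by
  have hpx : (mat p *ᵥ x) (Fin.last r) = 0 := by
    rw [Matrix.mulVec, dotProduct]
    refine Finset.sum_eq_zero fun j _ => ?_
    by_cases hj : j = Fin.last r
    · rw [hj, hx, mul_zero]
    · rw [isParabolic_last hp hj, zero_mul]
  have h := congrArg norm (form_mulVec p x)
  rwa [form_eq_midSq hx, form_eq_midSq hpx, norm_algebraMap', norm_algebraMap',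
    Real.norm_of_nonneg (midSq_nonneg _), Real.norm_of_nonneg (midSq_nonneg _)] at h

/-- The last column of `g - 1`. -/
def lastCol (g : Grp F r) : Fin (r + 1) → F := fun i => (mat g - 1) i (Fin.last r)

theorem lastCol_last {q : Grp F r} (hq : IsUnipotent q) : lastCol q (Fin.last r) = 0 := by
  rw [lastCol, Matrix.sub_apply, hq _ _ (Or.inr (Or.inl rfl)), Matrix.one_apply, sub_self]

/-- The `(j, last)` entry of `q* S q = S` says that the first row of `q` is minus the conjugate of
its last column at middle indices. Hence the last column alone controls `q - 1`. -/
theorem norm_unipotent_zero_apply {q : Grp F r} (hq : IsUnipotent q) {j : Fin (r + 1)}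
    (h0 : j ≠ 0) (hl : j ≠ Fin.last r) : ‖(mat q - 1) 0 j‖ = ‖lastCol q j‖ := by
  have h : ((mat q)ᴴ * (formS F r * mat q)) j (Fin.last r) = formS F r j (Fin.last r) := by
    rw [← Matrix.mul_assoc, conjTranspose_formS_mul]
  have hlast : (0 : Fin (r + 1)) ≠ Fin.last r := by
    intro h
    have h1 := congrArg Fin.val h
    have h2 := j.2
    have h3 := mt (fun h : j.val = 0 => Fin.ext h) h0
    simp only [Fin.val_zero, Fin.val_last] at h1
    omega
  rw [Matrix.mul_apply, Finset.sum_eq_add 0 j h0.symm] at h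
  · simp only [Matrix.conjTranspose_apply, formS_mul_apply, Equiv.swap_apply_left,
      Equiv.swap_apply_of_ne_of_ne h0 hl] at h
    rw [hq (Fin.last r) (Fin.last r) (Or.inr (Or.inl rfl)), hq j j (Or.inr (Or.inr ⟨h0, hl⟩))] at h
    simp only [if_true, star_one, mul_one, one_mul, formS, Matrix.of_apply,
      Equiv.swap_apply_of_ne_of_ne h0 hl, hl.symm, if_false] at h
    rw [lastCol, Matrix.sub_apply, Matrix.sub_apply, Matrix.one_apply_ne h0.symm,
      Matrix.one_apply_ne hl, sub_zero, sub_zero, eq_neg_of_add_eq_zero_right h, norm_neg,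
      norm_star]
  · intro i _ hi
    rw [Matrix.conjTranspose_apply, hq i j (Or.inr (Or.inr ⟨hi.1, hl⟩)), if_neg hi.2, star_zero,
      zero_mul]
  · simp
  · simp

theorem norm_unipotent_sub_one_le {q : Grp F r} (hq : IsUnipotent q) (i j : Fin (r + 1)) :
    ‖(mat q - 1) i j‖ ≤ Real.sqrt (midSq (lastCol q)) + ‖lastCol q 0‖ := by
  by_cases h : j = 0 ∨ i = Fin.last r ∨ (i ≠ 0 ∧ j ≠ Fin.last r)
  · rw [Matrix.sub_apply, hq i j h, Matrix.one_apply, sub_self, norm_zero]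
    positivity
  · push Not at h
    obtain ⟨hj, hi, hij⟩ := h
    by_cases hjl : j = Fin.last r
    · rw [hjl]
      by_cases hi0 : i = 0
      · rw [hi0]
        exact le_add_of_nonneg_left (Real.sqrt_nonneg _)
      · exact (norm_le_sqrt_midSq (lastCol q) hi0 hi).trans
          (le_add_of_nonneg_right (norm_nonneg _))
    · have hi0 : i = 0 := by
        by_contra hi0
        exact hjl (hij hi0)
      rw [hi0, norm_unipotent_zero_apply hq hj hjl]
      exact (norm_le_sqrt_midSq (lastCol q) hj hjl).trans
          (le_add_of_nonneg_right (norm_nonneg _))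

theorem mulVec_lastCol_conj (p q : Grp F r) (i : Fin (r + 1)) :
    (mat p *ᵥ lastCol (p⁻¹ * q * p)) i = ((mat q - 1) * mat p) i (Fin.last r) := by
  have h : mat p * (mat (p⁻¹ * q * p) - 1) = (mat q - 1) * mat p := by
    rw [Matrix.mul_sub, Matrix.sub_mul, ← mat_mul, ← mat_mul, Matrix.mul_one, Matrix.one_mul]
    congr 2
    group
  rw [← h]
  rfl

/-- Apply `p` to the last column of `p⁻¹qp - 1`: this preserves `midSq`, and the middle coordinates
of the result are those of the last column of `q - 1` times the last diagonal entry of `p`. -/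
theorem midSq_lastCol_conj {p q : Grp F r} (hp : IsParabolic p) (hq : IsUnipotent q) :
    midSq (lastCol (p⁻¹ * q * p))
      = ‖mat p (Fin.last r) (Fin.last r)‖ ^ 2 * midSq (lastCol q) := by
  rw [← midSq_mulVec hp (lastCol_last (isUnipotent_conj hp hq)), midSq, midSq, Finset.mul_sum]
  refine Finset.sum_congr rfl fun i _ => ?_
  split_ifs with h
  · rw [mul_zero]
  · push Not at h
    rw [mulVec_lastCol_conj, Matrix.mul_apply, Finset.sum_eq_single (Fin.last r), norm_mul,
      mul_pow, mul_comm]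
    · rfl
    · intro k _ hk
      rw [Matrix.sub_apply, hq i k (Or.inr (Or.inr ⟨h.1, hk⟩)), Matrix.one_apply, sub_self,
        zero_mul]
    · simp

/-- Row `0` of `p(p⁻¹qp - 1) = (q - 1)p` is solved for the corner entry, using that `p 0 0` has norm
inverse to that of the last diagonal entry. The corner contracts quadratically, up to errors
governed by the middle coordinates, whose decay is already known. -/
theorem norm_lastCol_conj_zero_le {p q : Grp F r} (hp : IsParabolic p) (hq : IsUnipotent q) :
    ‖lastCol (p⁻¹ * q * p) 0‖ ≤ ‖mat p (Fin.last r) (Fin.last r)‖ *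
      (‖mat p (Fin.last r) (Fin.last r)‖ * ‖lastCol q 0‖ +
        (∑ k, ‖mat p 0 k‖) * Real.sqrt (midSq (lastCol (p⁻¹ * q * p))) +
        (∑ k, ‖mat p k (Fin.last r)‖) * Real.sqrt (midSq (lastCol q))) := by
  set ρ := ‖mat p (Fin.last r) (Fin.last r)‖ with hρ
  set z := lastCol (p⁻¹ * q * p) with hz
  have hu := isUnipotent_conj hp hq
  have h1 := mulVec_lastCol_conj p q 0
  rw [← hz, Matrix.mulVec, dotProduct, ← Finset.add_sum_erase _ _ (Finset.mem_univ 0),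
    Matrix.mul_apply, ← Finset.add_sum_erase _ _ (Finset.mem_univ (Fin.last r))] at h1
  have h2 : ‖∑ k ∈ Finset.univ.erase 0, mat p 0 k * z k‖
      ≤ (∑ k, ‖mat p 0 k‖) * Real.sqrt (midSq z) := by
    rw [Finset.sum_mul]
    refine (norm_sum_le _ _).trans ((Finset.sum_le_sum fun k hk => ?_).trans
      (Finset.sum_le_univ_sum_of_nonneg fun k => by positivity))
    rw [norm_mul]
    gcongr
    by_cases hkl : k = Fin.last r
    · rw [hkl, hz, lastCol_last hu, norm_zero]
      positivity
    · exact norm_le_sqrt_midSq z (Finset.ne_of_mem_erase hk) hkl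
  have h3 : ‖∑ k ∈ Finset.univ.erase (Fin.last r), (mat q - 1) 0 k * mat p k (Fin.last r)‖
      ≤ (∑ k, ‖mat p k (Fin.last r)‖) * Real.sqrt (midSq (lastCol q)) := by
    rw [Finset.sum_mul]
    refine (norm_sum_le _ _).trans ((Finset.sum_le_sum fun k hk => ?_).trans
      (Finset.sum_le_univ_sum_of_nonneg fun k => by positivity))
    rw [norm_mul, mul_comm]
    gcongr
    by_cases hk0 : k = 0
    · rw [hk0, Matrix.sub_apply, hq 0 0 (Or.inl rfl), Matrix.one_apply, sub_self, norm_zero]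
      positivity
    · rw [norm_unipotent_zero_apply hq hk0 (Finset.ne_of_mem_erase hk)]
      exact norm_le_sqrt_midSq _ hk0 (Finset.ne_of_mem_erase hk)
  have h4 : ‖mat p 0 0 * z 0‖ ≤ ρ * ‖lastCol q 0‖ + (∑ k, ‖mat p 0 k‖) * Real.sqrt (midSq z) +
        (∑ k, ‖mat p k (Fin.last r)‖) * Real.sqrt (midSq (lastCol q)) := by
    rw [eq_sub_of_add_eq h1]
    refine (norm_sub_le _ _).trans ?_
    have h5 := norm_add_le ((mat q - 1) 0 (Fin.last r) * mat p (Fin.last r) (Fin.last r))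
      (∑ k ∈ Finset.univ.erase (Fin.last r), (mat q - 1) 0 k * mat p k (Fin.last r))
    have h6 : ‖(mat q - 1) 0 (Fin.last r) * mat p (Fin.last r) (Fin.last r)‖
        = ρ * ‖lastCol q 0‖ := by
      rw [norm_mul, mul_comm]
      rfl
    linarith
  calc ‖z 0‖ = ρ * ‖mat p 0 0 * z 0‖ := by
        rw [norm_mul, ← mul_assoc, hρ, norm_isParabolic_zero_last hp, one_mul]
    _ ≤ _ := by gcongr

/-- Conjugation by the powers of a contracting parabolic element carries a unipotent element to
the identity. -/
theorem tendsto_conj_pow {p n : Grp F r} (hp : IsParabolic p) (hn : IsUnipotent n)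
    (hlt : ‖mat p (Fin.last r) (Fin.last r)‖ < 1) :
    Tendsto (fun k : ℕ => (p ^ k)⁻¹ * n * p ^ k) atTop (𝓝 1) := by
  set ρ := ‖mat p (Fin.last r) (Fin.last r)‖ with hρ
  have hρ0 : 0 < ρ := by
    refine lt_of_le_of_ne (norm_nonneg _) fun h => ?_
    have := norm_isParabolic_zero_last hp
    rw [← hρ, ← h, zero_mul] at this
    exact zero_ne_one this
  set q : ℕ → Grp F r := fun k => (p ^ k)⁻¹ * n * p ^ k with hq
  have hsucc : ∀ k, q (k + 1) = p⁻¹ * q k * p := by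
    intro k
    simp only [hq, pow_succ]
    group
  have hu : ∀ k, IsUnipotent (q k) := by
    intro k
    induction k with
    | zero => simpa [hq] using hn
    | succ k ih => rw [hsucc]; exact isUnipotent_conj hp ih
  set β := Real.sqrt (midSq (lastCol n)) with hβ
  have hb : ∀ k, Real.sqrt (midSq (lastCol (q k))) = ρ ^ k * β := by
    intro k
    induction k with
    | zero => simp [hq, hβ]
    | succ k ih =>
      rw [hsucc, midSq_lastCol_conj hp (hu k), Real.sqrt_mul (sq_nonneg _),
        Real.sqrt_sq (norm_nonneg _), ih, ← hρ, pow_succ]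
      ring
  set C := (∑ k, ‖mat p 0 k‖) * ρ + ∑ k, ‖mat p k (Fin.last r)‖ with hC
  have hC0 : 0 ≤ C := by positivity
  -- With `x` the corner norm, the recursion is `x (k+1) ≤ ρ (ρ x k + Cβ ρ^k)`. The bound `x k ≤ D
  -- ρ^k` propagates as soon as `D ≥ x 0` and `ρD + Cβ ≤ D`; this `D` satisfies both.
  set D := ‖lastCol n 0‖ + C * β / (1 - ρ) with hD
  have h1ρ : 0 < 1 - ρ := sub_pos.2 hlt
  have hDC : ρ * D + C * β ≤ D := by
    have h1 : C * β / (1 - ρ) * (1 - ρ) = C * β := div_mul_cancel₀ _ h1ρ.ne'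
    have h2 : 0 ≤ ‖lastCol n 0‖ * (1 - ρ) := by positivity
    nlinarith
  have hc : ∀ k, ‖lastCol (q k) 0‖ ≤ D * ρ ^ k := by
    intro k
    induction k with
    | zero =>
      have : 0 ≤ C * β / (1 - ρ) := by positivity
      simp only [hq, pow_zero, inv_one, one_mul, mul_one]
      linarith
    | succ k ih =>
      have h := norm_lastCol_conj_zero_le hp (hu k)
      rw [← hsucc, hb, hb, ← hρ] at h
      have h1 : ρ * ‖lastCol (q k) 0‖ ≤ ρ * (D * ρ ^ k) := by gcongr
      have h2 : ρ ^ k * (ρ * D + C * β) ≤ ρ ^ k * D := by gcongr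
      calc _ ≤ _ := h
        _ ≤ ρ * (ρ ^ k * (ρ * D + C * β)) := by
          gcongr
          rw [show ρ ^ k * (ρ * D + C * β) = ρ * (D * ρ ^ k) +
            (∑ k, ‖mat p 0 k‖) * (ρ ^ (k + 1) * β) +
              (∑ k, ‖mat p k (Fin.last r)‖) * (ρ ^ k * β) by rw [hC]; ring]
          gcongr
        _ ≤ ρ * (ρ ^ k * D) := by gcongr
        _ = D * ρ ^ (k + 1) := by ring
  rw [tendsto_iff_mat]
  intro i j
  rw [tendsto_iff_norm_sub_tendsto_zero]
  have hlim : Tendsto (fun k : ℕ => ρ ^ k * β + D * ρ ^ k) atTop (𝓝 0) := by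
    have h := tendsto_pow_atTop_nhds_zero_of_lt_one hρ0.le hlt
    simpa using (h.mul_const β).add (h.const_mul D)
  refine squeeze_zero (fun _ => norm_nonneg _) (fun k => ?_) hlim
  have := norm_unipotent_sub_one_le (hu k) i j
  rw [hb] at this
  exact this.trans (by gcongr; exact hc k)

/-- If the discrete group `Γ` contains a nontrivial unipotent element, its parabolic elements
preserve the height. -/
theorem norm_parabolic_last_eq_one {Γ : Subgroup (Grp F r)} [DiscreteTopology Γ]
    {n : Grp F r} (hnΓ : n ∈ Γ) (hn : IsUnipotent n) (hn1 : n ≠ 1)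
    {p : Grp F r} (hpΓ : p ∈ Γ) (hp : IsParabolic p) :
    ‖mat p (Fin.last r) (Fin.last r)‖ = 1 := by
  have key : ∀ p ∈ Γ, IsParabolic p → ¬ ‖mat p (Fin.last r) (Fin.last r)‖ < 1 := by
    intro p hpΓ hp hlt
    have h := tendsto_conj_pow hp hn hlt
    let q : ℕ → Γ := fun k =>
      ⟨(p ^ k)⁻¹ * n * p ^ k, Γ.mul_mem (Γ.mul_mem (Γ.inv_mem (Γ.pow_mem hpΓ k)) hnΓ)
        (Γ.pow_mem hpΓ k)⟩
    have hq : Tendsto q atTop (𝓝 1) := tendsto_subtype_rng.2 h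
    rw [nhds_discrete, tendsto_pure] at hq
    obtain ⟨k, hk⟩ := hq.exists
    have hk' : (p ^ k)⁻¹ * n * p ^ k = 1 := congrArg Subtype.val hk
    exact hn1 (by simpa [mul_assoc, inv_mul_eq_one, eq_comm] using hk')
  -- Neither `p` nor `p⁻¹` contracts, and their last diagonal entries have inverse norms.
  have h1 := norm_isParabolic_inv_last hp
  have h2 := key p hpΓ hp
  have h3 := key p⁻¹ (Γ.inv_mem hpΓ) (isParabolic_inv hp)
  push Not at h2 h3
  nlinarith

end Discrete

/-! ### Noncompactness of `N`, and local finiteness of the horoballs. -/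

section Noncompact

variable {F : Type} [NormedRing F] [StarRing F] [NormedAlgebra ℝ F] [StarModule ℝ F]
  [ContinuousStar F] {r : ℕ}

variable (F r) in
/-- The unipotent radical `N` is not compact. -/
def NoncompactUnipotent : Prop :=
  ¬ ∃ C : Set (Grp F r), IsCompact C ∧ ∀ n : Grp F r, IsUnipotent n → n ∈ C

/-- Since `X³ = 0`, the right factor is `exp X`. The relation `X'S = -SX` moves the left factor past
`S` as `exp(-X)`, truncated in the same way. -/
theorem exp_cubic_identity {R : Type*} [Ring R] [Algebra ℝ R] {S X X' : R}
    (h : X' * S = -(S * X)) (h3 : X * X * X = 0) :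
    (1 + X' + (2⁻¹ : ℝ) • (X' * X')) * S * (1 + X + (2⁻¹ : ℝ) • (X * X)) = S := by
  have h1 : X' * X' * S = S * (X * X) := by
    rw [mul_assoc, h, mul_neg, ← mul_assoc, h, neg_mul, neg_neg, mul_assoc]
  have h2 : (1 + X' + (2⁻¹ : ℝ) • (X' * X')) * S
      = S * (1 - X + (2⁻¹ : ℝ) • (X * X)) := by
    rw [add_mul, add_mul, smul_mul_assoc, h1, h, one_mul, mul_add, mul_sub, mul_one,
      mul_smul_comm]
    abel
  have h4 : X * (X * X) = 0 := by rw [← mul_assoc, h3]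
  rw [h2, mul_assoc]
  conv_rhs => rw [← mul_one S]
  congr 1
  simp only [add_mul, sub_mul, mul_add, smul_mul_assoc, mul_smul_comm, mul_assoc, h4,
    one_mul, mul_one, mul_zero, smul_zero]
  module

/-- The one-parameter group `exp(sX)` is the quadratic polynomial `1 + sX + s²X²/2`, because `X` is
strictly block upper triangular with three blocks. It lies in `N` and is unbounded. -/
theorem noncompactUnipotent_of_lieAlg {X : Matrix (Fin (r + 1)) (Fin (r + 1)) F}
    (hX : X ∈ lieAlg F r)
    (hz : ∀ i j, (j = 0 ∨ i = Fin.last r ∨ (i ≠ 0 ∧ j ≠ Fin.last r)) → X i j = 0)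
    (hne : X ≠ 0) : NoncompactUnipotent F r := by
  rintro ⟨C, hC, hN⟩
  have hlie : ∀ s : ℝ, (s • X)ᴴ * formS F r = -(formS F r * (s • X)) := fun s =>
    eq_neg_of_add_eq_zero_left ((lieAlg F r).smul_mem s hX)
  have hlie' : ∀ s : ℝ, (s • X) * formS F r = -(formS F r * (s • X)ᴴ) := fun s => by
    have h := congrArg (fun A => formS F r * A * formS F r) (hlie s)
    simp only [Matrix.mul_neg, Matrix.neg_mul, ← Matrix.mul_assoc, formS_mul_self,
      Matrix.one_mul] at h
    rw [Matrix.mul_assoc, formS_mul_self, Matrix.mul_one] at h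
    rw [h, neg_neg]
  have hzz : ∀ i j, (j = 0 ∨ i = Fin.last r ∨ (i ≠ 0 ∧ j ≠ Fin.last r)) → (X * X) i j = 0 := by
    intro i j h
    rw [Matrix.mul_apply]
    refine Finset.sum_eq_zero fun k _ => ?_
    rcases h with rfl | rfl | ⟨hi, hj⟩
    · exact mul_eq_zero_of_right _ (hz _ _ (Or.inl rfl))
    · exact mul_eq_zero_of_left (hz _ _ (Or.inr (Or.inl rfl))) _
    · by_cases hk : k = Fin.last r
      · exact mul_eq_zero_of_right _ (hz _ _ (Or.inr (Or.inl hk)))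
      · exact mul_eq_zero_of_left (hz _ _ (Or.inr (Or.inr ⟨hi, hk⟩))) _
  have h3 : X * X * X = 0 := by
    ext i j
    rw [Matrix.mul_apply, Matrix.zero_apply]
    refine Finset.sum_eq_zero fun k _ => ?_
    by_cases hi : i = 0 ∧ k = Fin.last r
    · exact mul_eq_zero_of_right _ (hz _ _ (Or.inr (Or.inl hi.2)))
    · rw [Matrix.mul_apply]
      refine mul_eq_zero_of_left (Finset.sum_eq_zero fun l _ => ?_) _
      by_cases hl : l = 0
      · exact mul_eq_zero_of_left (hz _ _ (Or.inl hl)) _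
      · by_cases hk : k = Fin.last r
        · by_cases hll : l = Fin.last r
          · exact mul_eq_zero_of_right _ (hz _ _ (Or.inr (Or.inl hll)))
          · exact mul_eq_zero_of_left
              (hz _ _ (Or.inr (Or.inr ⟨fun h => hi ⟨h, hk⟩, hll⟩))) _
        · exact mul_eq_zero_of_right _ (hz _ _ (Or.inr (Or.inr ⟨hl, hk⟩)))
  have h3s : ∀ s : ℝ, (s • X) * (s • X) * (s • X) = 0 := fun s => by simp [h3]
  have h3s' : ∀ s : ℝ, (s • X)ᴴ * (s • X)ᴴ * (s • X)ᴴ = 0 := fun s => by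
    rw [← Matrix.conjTranspose_mul, ← Matrix.conjTranspose_mul, ← Matrix.mul_assoc, h3s,
      Matrix.conjTranspose_zero]
  let A : ℝ → Matrix (Fin (r + 1)) (Fin (r + 1)) F := fun s =>
    1 + s • X + (2⁻¹ : ℝ) • ((s • X) * (s • X))
  have hAH : ∀ s, (A s)ᴴ = 1 + (s • X)ᴴ + (2⁻¹ : ℝ) • ((s • X)ᴴ * (s • X)ᴴ) := fun s => by
    simp only [A, Matrix.conjTranspose_add, Matrix.conjTranspose_one,
      Matrix.conjTranspose_smul, Matrix.conjTranspose_mul, star_trivial]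
  have hA1 : ∀ s, (A s)ᴴ * formS F r * A s = formS F r := fun s => by
    rw [hAH]; exact exp_cubic_identity (hlie s) (h3s s)
  have hA2 : ∀ s, A s * formS F r * (A s)ᴴ = formS F r := fun s => by
    rw [hAH]; exact exp_cubic_identity (hlie' s) (h3s' s)
  have hAC : ∀ s, ofMatrix (A s) (hA1 s) (hA2 s) ∈ C := fun s => by
    refine hN _ fun i j h => ?_
    rw [mat_ofMatrix]
    simp only [A, Matrix.add_apply, Matrix.smul_apply, Matrix.smul_mul, Matrix.mul_smul,
      hz i j h, hzz i j h, smul_zero, add_zero, Matrix.one_apply]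
  refine hne ?_
  ext i j
  have hcont : Continuous fun g : Grp F r => mat g i j :=
    (continuous_apply_apply i j).comp continuous_mat
  obtain ⟨B, hB⟩ := (hC.image hcont).isBounded.exists_norm_le
  have hbd : ∀ s : ℝ, ‖A s i j‖ ≤ B := fun s => hB _ ⟨_, hAC s, rfl⟩
  by_contra h0
  have hpos : 0 < ‖X i j‖ := norm_pos_iff.2 h0
  have hs : ∀ s : ℝ, (2 * s) * ‖X i j‖ ≤ 2 * B := fun s => by
    -- The odd part in `s` isolates the linear term, whatever the entry of `X²` is.
    have h1 : A s i j - A (-s) i j = (2 * s) • X i j := by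
      simp only [A, Matrix.add_apply, Matrix.smul_apply, Matrix.smul_mul, Matrix.mul_smul]
      module
    have h2 := norm_sub_le (A s i j) (A (-s) i j)
    rw [h1, norm_smul] at h2
    have h3 := hbd s
    have h4 := hbd (-s)
    have h5 : (2 * s) * ‖X i j‖ ≤ ‖2 * s‖ * ‖X i j‖ := by
      gcongr
      exact Real.le_norm_self _
    linarith
  have := hs ((B + 1) / ‖X i j‖)
  rw [mul_assoc, div_mul_cancel₀ _ hpos.ne'] at this
  linarith

theorem mem_lieAlg_iff {X : Matrix (Fin (r + 1)) (Fin (r + 1)) F} :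
    X ∈ lieAlg F r ↔ ∀ i j, star (X (Equiv.swap 0 (Fin.last r) j) i)
      + X (Equiv.swap 0 (Fin.last r) i) j = 0 := by
  change Xᴴ * formS F r + formS F r * X = 0 ↔ _
  rw [← Matrix.ext_iff]
  simp only [Matrix.add_apply, mul_formS_apply, formS_mul_apply, Matrix.conjTranspose_apply,
    Matrix.zero_apply]

/-- A purely imaginary scalar in the upper right corner is a direction in the Lie algebra of `N`,
even when there are no middle coordinates. -/
theorem noncompactUnipotent_of_imaginary (hr : 1 ≤ r) {ι : F} (hι : star ι = -ι) (h0 : ι ≠ 0) :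
    NoncompactUnipotent F r := by
  have hl : (Fin.last r) ≠ 0 := by
    intro h
    have := congrArg Fin.val h
    simp at this
    omega
  refine noncompactUnipotent_of_lieAlg
    (X := Matrix.of fun i j => if i = 0 ∧ j = Fin.last r then ι else 0) ?_ ?_ ?_
  · rw [mem_lieAlg_iff]
    intro i j
    simp only [Matrix.of_apply, Equiv.swap_apply_eq_iff, Equiv.swap_apply_left]
    by_cases h1 : i = Fin.last r <;> by_cases h2 : j = Fin.last r <;> simp [h1, h2, hι]
  · rintro i j h
    rw [Matrix.of_apply, if_neg]
    rintro ⟨rfl, rfl⟩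
    rcases h with h | h | h
    · exact hl h
    · exact hl h.symm
    · exact h.1 rfl
  · intro h
    have := congrFun (congrFun h 0) (Fin.last r)
    simp at this
    exact h0 this

/-- Without imaginary scalars a middle index is needed: for `ℝ` and `r = 1` the group `N` is
trivial. -/
theorem noncompactUnipotent_of_two_le [Nontrivial F] (hr : 2 ≤ r) :
    NoncompactUnipotent F r := by
  let m : Fin (r + 1) := ⟨1, by omega⟩
  have hl : (Fin.last r) ≠ 0 := by
    intro h
    have := congrArg Fin.val h
    simp at this
    omega
  have hm0 : m ≠ 0 := by
    intro h
    have := congrArg Fin.val h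
    simp [m] at this
  have hml : m ≠ Fin.last r := by
    intro h
    have := congrArg Fin.val h
    simp [m] at this
    omega
  have hsm : Equiv.swap 0 (Fin.last r) m = m := Equiv.swap_apply_of_ne_of_ne hm0 hml
  refine noncompactUnipotent_of_lieAlg
    (X := Matrix.of fun i j => (if i = m ∧ j = Fin.last r then 1 else 0)
      - if i = 0 ∧ j = m then 1 else 0) ?_ ?_ ?_
  · rw [mem_lieAlg_iff]
    intro i j
    simp only [Matrix.of_apply, Equiv.swap_apply_eq_iff, Equiv.swap_apply_left, hsm]
    by_cases h1 : i = Fin.last r <;> by_cases h2 : j = Fin.last r <;>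
      by_cases h3 : i = m <;> by_cases h4 : j = m <;> simp_all
  · rintro i j h
    have h1 : ¬ (i = m ∧ j = Fin.last r) := by
      rintro ⟨rfl, rfl⟩
      rcases h with h | h | h
      · exact hl h
      · exact hml h
      · exact h.2 rfl
    have h2 : ¬ (i = 0 ∧ j = m) := by
      rintro ⟨rfl, rfl⟩
      rcases h with h | h | h
      · exact hm0 h
      · exact hl h.symm
      · exact h.1 rfl
    simp [h1, h2]
  · intro h
    have := congrFun (congrFun h m) (Fin.last r)
    simp [hm0] at this

variable [NormOneClass F] [NormMulClass F] [NormedStarGroup F] [CompositionScalars F]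

/-- The parabolic elements of `Γ` preserve the height. -/
theorem height_mul_of_cocompact (hN : NoncompactUnipotent F r) {Γ : Subgroup (Grp F r)}
    (hΓ : DiscreteTopology Γ) (hco : UnipotentCocompact Γ) {p : Grp F r} (hpΓ : p ∈ Γ)
    (hp : IsParabolic p) (g : Grp F r) : height (p * g) = height g := by
  -- If `Γ ∩ N` were trivial, the compact set covering `N` modulo `Γ ∩ N` would contain `N`.
  have hex : ∃ n ∈ Γ, IsUnipotent n ∧ n ≠ 1 := by
    by_contra! h
    obtain ⟨C, hC, hCN⟩ := hco
    refine hN ⟨C, hC, fun n hn => ?_⟩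
    obtain ⟨γ, hγ, hγu, hγn⟩ := hCN n hn
    rwa [h γ hγ hγu, one_mul] at hγn
  obtain ⟨n, hnΓ, hn, hn1⟩ := hex
  rw [height_parabolic_mul hp, norm_parabolic_last_eq_one hnΓ hn hn1 hpΓ hp, inv_one, one_mul]

/-! ### Local finiteness of the horoballs -/

/-- `P` and `SPS` are idempotents with `P · SPS = SPS · P = 0`, exchanged by conjugation with `S`.
The matrix scales one image by `ε`, the other by `ε⁻¹`, and is the identity on the common kernel, so
it preserves the form. -/
theorem idempotent_identity {R : Type*} [Ring R] [Algebra ℝ R] {S P : R} (hS : S * S = 1)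
    (hP : P * P = P) (h0 : P * S * P = 0) {ε : ℝ} (hε : ε ≠ 0) :
    (1 + (ε - 1) • P + (ε⁻¹ - 1) • (S * P * S)) * S *
      (1 + (ε - 1) • P + (ε⁻¹ - 1) • (S * P * S)) = S := by
  have h1 : (1 + (ε - 1) • P + (ε⁻¹ - 1) • (S * P * S)) * S
      = S + (ε - 1) • (P * S) + (ε⁻¹ - 1) • (S * P) := by
    rw [add_mul, add_mul, one_mul, smul_mul_assoc, smul_mul_assoc, mul_assoc (S * P), hS,
      mul_one]
  have h2 : P * S * (S * P * S) = P * S := by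
    rw [← mul_assoc, ← mul_assoc, mul_assoc P, hS, mul_one, hP]
  have h3 : S * P * (S * P * S) = 0 := by
    rw [← mul_assoc, ← mul_assoc, mul_assoc S P S, mul_assoc S, h0, mul_zero, zero_mul]
  have h4 : S * (S * P * S) = P * S := by rw [← mul_assoc, ← mul_assoc, hS, one_mul]
  have h5 : S * P * P = S * P := by rw [mul_assoc, hP]
  have h6 : ε * ε⁻¹ = 1 := mul_inv_cancel₀ hε
  rw [h1]
  simp only [mul_add, add_mul, mul_one, smul_mul_assoc, mul_smul_comm, h0, h2, h3, h4, h5,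
    smul_zero, add_zero]
  match_scalars <;> first | ring1 | linear_combination h6

/-- An isotropic row vector can be shrunk arbitrarily by an element of `G`. -/
theorem exists_shrink {v : Fin (r + 1) → F}
    (hv : v ⬝ᵥ (formS F r *ᵥ star v) = 0) {δ : ℝ} (hδ : 0 < δ) :
    ∃ b : Grp F r, ∑ j, ‖∑ i, v i * mat b i j‖ ^ 2 < δ := by
  set N := ∑ j, ‖v j‖ ^ 2 with hN
  rcases eq_or_ne N 0 with h0 | h0
  · refine ⟨1, ?_⟩
    have hv0 : ∀ j, v j = 0 := fun j => by
      have := (Finset.sum_eq_zero_iff_of_nonneg (fun j _ => sq_nonneg ‖v j‖)).1 h0 j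
        (Finset.mem_univ j)
      simpa using this
    simpa [hv0] using hδ
  have hNpos : 0 < N := lt_of_le_of_ne (Finset.sum_nonneg fun _ _ => sq_nonneg _) h0.symm
  let w : Matrix (Fin 1) (Fin (r + 1)) F := Matrix.of fun _ j => v j
  have hww : w * wᴴ = N • 1 := by
    ext a b
    rw [Subsingleton.elim a b, Matrix.mul_apply, Matrix.smul_apply, Matrix.one_apply_eq, hN,
      Finset.sum_smul]
    refine Finset.sum_congr rfl fun j _ => ?_
    rw [Matrix.conjTranspose_apply, ← Algebra.algebraMap_eq_smul_one]
    exact CompositionScalars.mul_star_self _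
  have hwSw : w * formS F r * wᴴ = 0 := by
    ext a b
    rw [Matrix.mul_assoc]
    exact hv
  -- `P` is the orthogonal projection attached to the row `v`. Isotropy of `v` is exactly what gives
  -- `P S P = 0`, and `vP = v`, `vSP = 0` make `v` an eigenrow of `A` with eigenvalue `ε`.
  let P : Matrix (Fin (r + 1)) (Fin (r + 1)) F := N⁻¹ • (wᴴ * w)
  have hwP : w * P = w := by
    change w * (N⁻¹ • (wᴴ * w)) = w
    rw [Matrix.mul_smul, ← Matrix.mul_assoc, hww, Matrix.smul_mul, Matrix.one_mul, smul_smul,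
      inv_mul_cancel₀ h0, one_smul]
  have hwSP : w * formS F r * P = 0 := by
    change w * formS F r * (N⁻¹ • (wᴴ * w)) = 0
    rw [Matrix.mul_smul, ← Matrix.mul_assoc, hwSw, Matrix.zero_mul, smul_zero]
  have hPP : P * P = P := by
    change (N⁻¹ • (wᴴ * w)) * P = N⁻¹ • (wᴴ * w)
    rw [Matrix.smul_mul, Matrix.mul_assoc, hwP]
  have hPSP : P * formS F r * P = 0 := by
    change (N⁻¹ • (wᴴ * w)) * formS F r * P = 0
    rw [Matrix.smul_mul, Matrix.smul_mul, Matrix.mul_assoc, Matrix.mul_assoc, ← Matrix.mul_assoc w,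
      hwSP, Matrix.mul_zero, smul_zero]
  have hPH : Pᴴ = P := by
    change (N⁻¹ • (wᴴ * w))ᴴ = N⁻¹ • (wᴴ * w)
    rw [Matrix.conjTranspose_smul, Matrix.conjTranspose_mul, Matrix.conjTranspose_conjTranspose,
      star_trivial]
  obtain ⟨ε, hε0, hε⟩ : ∃ ε : ℝ, 0 < ε ∧ ε ^ 2 * N < δ := by
    refine ⟨Real.sqrt (δ / (2 * N)), by positivity, ?_⟩
    rw [Real.sq_sqrt (by positivity)]
    field_simp
    norm_num
  let A := 1 + (ε - 1) • P + (ε⁻¹ - 1) • (formS F r * P * formS F r)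
  have hAH : Aᴴ = A := by
    simp only [A, Matrix.conjTranspose_add, Matrix.conjTranspose_one, Matrix.conjTranspose_smul,
      Matrix.conjTranspose_mul, star_trivial, hPH, formS_conjTranspose, Matrix.mul_assoc]
  have hASA : A * formS F r * A = formS F r :=
    idempotent_identity formS_mul_self hPP hPSP hε0.ne'
  have hwA : w * A = ε • w := by
    simp only [A, Matrix.mul_add, Matrix.mul_smul, Matrix.mul_one]
    rw [hwP, ← Matrix.mul_assoc, ← Matrix.mul_assoc, hwSP, Matrix.zero_mul]
    module
  refine ⟨ofMatrix A (by rw [hAH, hASA]) (by rw [hAH, hASA]), ?_⟩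
  rw [mat_ofMatrix]
  have hj : ∀ j, ∑ i, v i * A i j = ε • v j := fun j =>
    congrFun (congrFun hwA 0) j
  simp only [hj, norm_smul, mul_pow]
  rw [← Finset.mul_sum, Real.norm_of_nonneg hε0.le]
  exact hε

variable (F r) in
/-- The parabolic subgroup `P`. -/
def parabolic : Subgroup (Grp F r) where
  carrier := {p | IsParabolic p}
  mul_mem' := isParabolic_mul
  one_mem' := fun _ hi => by rw [mat_one, Matrix.one_apply_ne hi]
  inv_mem' := isParabolic_inv

theorem last_row_isotropic (hr : 1 ≤ r) (g : Grp F r) :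
    mat g (Fin.last r) ⬝ᵥ (formS F r *ᵥ star (mat g (Fin.last r))) = 0 := by
  have hl : (Fin.last r) ≠ 0 := by
    intro h
    have := congrArg Fin.val h
    simp at this
    omega
  have h := congrFun (congrFun (mul_formS_conjTranspose g) (Fin.last r)) (Fin.last r)
  rw [Matrix.mul_assoc] at h
  refine Eq.trans h ?_
  simp [formS, hl]

/-- The height `a` may lie below `c`, where separation says nothing. The last rows of `γ n * g` are
bounded, hence accumulate at some vector, isotropic as a limit of isotropic rows. An element `b`
shrinking this limit makes late rows of the subsequence so short that two of the points `γ n * (g *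
b)` lie above `c`, where separation applies. -/
theorem exists_equivalent [FiniteDimensional ℝ F] (hr : 1 ≤ r) {Γ : Subgroup (Grp F r)} {c : ℝ}
    (hc : IsCuspHeight Γ c) (g : Grp F r) {a : ℝ} (ha : 0 < a) (γ : ℕ → Grp F r)
    (hγ : ∀ n, γ n ∈ Γ) (hγa : ∀ n, a < height (γ n * g)) :
    ∃ m n, m ≠ n ∧ IsParabolic (γ m * (γ n)⁻¹) := by
  have : ProperSpace F := FiniteDimensional.proper ℝ F
  let x : ℕ → Fin (r + 1) → F := fun n => mat (γ n * g) (Fin.last r)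
  have hx : ∀ n, x n ∈ Metric.closedBall (0 : Fin (r + 1) → F) a⁻¹ := fun n => by
    rw [mem_closedBall_zero_iff, pi_norm_le_iff_of_nonneg (inv_pos.2 ha).le]
    intro j
    have h := (lt_height_iff ha _).1 (hγa n)
    have h1 : ‖x n j‖ ^ 2 ≤ rowSq (mat (γ n * g)) :=
      Finset.single_le_sum (f := fun j => ‖x n j‖ ^ 2) (fun _ _ => sq_nonneg _)
        (Finset.mem_univ j)
    exact (pow_le_pow_iff_left₀ (norm_nonneg _) (inv_pos.2 ha).le two_ne_zero).1 (h1.trans h.le)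
  obtain ⟨v, -, θ, hθ, hlim⟩ := tendsto_subseq_of_bounded Metric.isBounded_closedBall hx
  have hv : v ⬝ᵥ (formS F r *ᵥ star v) = 0 := by
    have hcont : Continuous fun y : Fin (r + 1) → F => y ⬝ᵥ (formS F r *ᵥ star y) := by
      fun_prop
    refine tendsto_nhds_unique ((hcont.tendsto v).comp hlim) ?_
    refine tendsto_const_nhds.congr fun n => ?_
    exact (last_row_isotropic hr _).symm
  obtain ⟨b, hb⟩ := exists_shrink hv (δ := c⁻¹ ^ 2) (by have := hc.1; positivity)
  have hcont : Continuous fun y : Fin (r + 1) → F => ∑ j, ‖∑ i, y i * mat b i j‖ ^ 2 := by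
    fun_prop
  have hev := ((hcont.tendsto v).comp hlim).eventually (gt_mem_nhds hb)
  obtain ⟨n₀, hn₀⟩ := eventually_atTop.1 hev
  have hh : ∀ n ≥ n₀, c < height (γ (θ n) * (g * b)) := fun n hn => by
    rw [lt_height_iff hc.1, ← mul_assoc, mat_mul]
    exact hn₀ n hn
  refine ⟨θ n₀, θ (n₀ + 1), (hθ (Nat.lt_succ_self n₀)).ne, ?_⟩
  refine hc.2 _ (Γ.mul_mem (hγ _) (Γ.inv_mem (hγ _))) (γ (θ (n₀ + 1)) * (g * b))
    (hh _ (Nat.le_succ n₀)) ?_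
  rw [mul_assoc, inv_mul_cancel_left]
  exact hh _ le_rfl

/-- Only finitely many horoballs of given height meet a point. -/
theorem exists_finset_representatives [FiniteDimensional ℝ F] (hr : 1 ≤ r)
    {Γ : Subgroup (Grp F r)} {c : ℝ} (hc : IsCuspHeight Γ c) (g : Grp F r) {a : ℝ} (ha : 0 < a) :
    ∃ T : Finset (Grp F r), (∀ γ ∈ T, γ ∈ Γ) ∧
      (∀ γ ∈ T, ∀ γ' ∈ T, γ ≠ γ' → ¬ IsParabolic (γ * γ'⁻¹)) ∧
      ∀ γ ∈ Γ, a < height (γ * g) → ∃ γ' ∈ T, IsParabolic (γ' * γ⁻¹) := by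
  classical
  let π : Grp F r → Quotient (QuotientGroup.rightRel (parabolic F r)) := Quotient.mk _
  have hπ : ∀ x y, π x = π y ↔ IsParabolic (y * x⁻¹) := fun x y =>
    Quotient.eq.trans QuotientGroup.rightRel_apply
  let A := π '' {γ | γ ∈ Γ ∧ a < height (γ * g)}
  have hA : A.Finite := by
    by_contra hinf
    let e := Set.Infinite.natEmbedding A hinf
    choose γ hγ hγe using fun n => (e n).2
    obtain ⟨m, n, hmn, hp⟩ := exists_equivalent hr hc g ha γ (fun n => (hγ n).1)
      (fun n => (hγ n).2)
    refine hmn (e.injective (Subtype.ext ?_))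
    rw [← hγe m, ← hγe n]
    exact ((hπ _ _).2 hp).symm
  choose! s hs hsπ using fun q (hq : q ∈ A) => hq
  refine ⟨hA.toFinset.image s, ?_, ?_, ?_⟩
  · intro γ hγ
    obtain ⟨q, hq, rfl⟩ := Finset.mem_image.1 hγ
    exact (hs q (hA.mem_toFinset.1 hq)).1
  · intro γ hγ γ' hγ' hne hp
    obtain ⟨q, hq, rfl⟩ := Finset.mem_image.1 hγ
    obtain ⟨q', hq', rfl⟩ := Finset.mem_image.1 hγ'
    have h := (hπ _ _).2 hp
    rw [hsπ q (hA.mem_toFinset.1 hq), hsπ q' (hA.mem_toFinset.1 hq')] at h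
    exact hne (congrArg s h.symm)
  · intro γ hγ hγa
    have hq : π γ ∈ A := ⟨γ, ⟨hγ, hγa⟩, rfl⟩
    exact ⟨s (π γ), Finset.mem_image_of_mem s (hA.mem_toFinset.2 hq),
      (hπ _ _).1 (hsπ _ hq).symm⟩

end Noncompact

/-! ### Differential calculus on `Γ\G` along right translations. -/

section Calculus

variable {F : Type} [NormedRing F] [StarRing F] [NormedAlgebra ℝ F] [ContinuousStar F] {r : ℕ}

theorem Quo.mk_eq_iff {Γ : Subgroup (Grp F r)} {g h : Grp F r} :
    Quo.mk Γ g = Quo.mk Γ h ↔ ∃ γ ∈ Γ, γ * h = g :=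
  Quotient.eq.trans ⟨fun ⟨γ, hγ⟩ => ⟨γ, γ.2, hγ⟩, fun ⟨γ, h1, h2⟩ => ⟨⟨γ, h1⟩, h2⟩⟩

theorem Quo.mk_mul_left {Γ : Subgroup (Grp F r)} {γ : Grp F r} (hγ : γ ∈ Γ) (g : Grp F r) :
    Quo.mk Γ (γ * g) = Quo.mk Γ g := Quo.mk_eq_iff.2 ⟨γ, hγ, rfl⟩

theorem Quo.mk_surjective (Γ : Subgroup (Grp F r)) : Function.Surjective (Quo.mk Γ) :=
  Quotient.mk_surjective

theorem Quo.rmul_mk {Γ : Subgroup (Grp F r)} (g h : Grp F r) :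
    (Quo.mk Γ g).rmul h = Quo.mk Γ (g * h) := rfl

theorem Quo.rmul_rmul {Γ : Subgroup (Grp F r)} (x : Quo Γ) (g h : Grp F r) :
    (x.rmul g).rmul h = x.rmul (g * h) := by
  obtain ⟨a, rfl⟩ := Quo.mk_surjective Γ x
  rw [Quo.rmul_mk, Quo.rmul_mk, Quo.rmul_mk, mul_assoc]

theorem Quo.rmul_one {Γ : Subgroup (Grp F r)} (x : Quo Γ) : x.rmul 1 = x := by
  obtain ⟨a, rfl⟩ := Quo.mk_surjective Γ x
  rw [Quo.rmul_mk, mul_one]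

theorem Quo.isOpenQuotientMap_mk (Γ : Subgroup (Grp F r)) : IsOpenQuotientMap (Quo.mk Γ) :=
  have : ContinuousConstSMul Γ (Grp F r) := ⟨fun γ => continuous_const_mul (γ : Grp F r)⟩
  ⟨Quo.mk_surjective Γ, continuous_quotient_mk', isOpenMap_quotient_mk'_mul⟩

theorem Quo.continuous_rmul (Γ : Subgroup (Grp F r)) :
    Continuous fun p : Quo Γ × Grp F r => p.1.rmul p.2 := by
  have h := (Quo.isOpenQuotientMap_mk Γ).prodMap (IsOpenQuotientMap.id (X := Grp F r))
  rw [h.isQuotientMap.continuous_iff]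
  exact (Quo.isOpenQuotientMap_mk Γ).continuous.comp continuous_mul

theorem SmoothFun.continuous {Γ : Subgroup (Grp F r)} {u : Quo Γ → ℂ} (hu : SmoothFun u) :
    Continuous u := by
  rw [(Quo.isOpenQuotientMap_mk Γ).isQuotientMap.continuous_iff, continuous_iff_continuousAt]
  intro g
  obtain ⟨U, Φ, hU, hg, hΦ, h⟩ := hu g
  have hmat : Continuous fun h : Grp F r => (fun i j => mat h i j) := continuous_mat
  have h1 : ContinuousAt (fun h : Grp F r => Φ fun i j => mat h i j) g :=
    ContinuousAt.comp (f := fun h : Grp F r => (fun i j => mat h i j))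
      (hΦ.continuousOn.continuousAt (hU.mem_nhds hg)) hmat.continuousAt
  refine h1.congr ?_
  filter_upwards [hmat.continuousAt.preimage_mem_nhds (hU.mem_nhds hg)] with k hk
  exact (h k hk).symm

/-- Smooth functions are closed under smooth binary operations. -/
theorem SmoothFun.comp₂ {Γ : Subgroup (Grp F r)} {u v : Quo Γ → ℂ} (hu : SmoothFun u)
    (hv : SmoothFun v) {B : ℂ × ℂ → ℂ} (hB : ContDiff ℝ ∞ B) :
    SmoothFun fun x => B (u x, v x) := by
  intro g
  obtain ⟨U, Φ, hU, hg, hΦ, h⟩ := hu g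
  obtain ⟨V, Ψ, hV, hg', hΨ, h'⟩ := hv g
  refine ⟨U ∩ V, fun A => B (Φ A, Ψ A), hU.inter hV, ⟨hg, hg'⟩, ?_, ?_⟩
  · exact hB.comp_contDiffOn
      ((hΦ.mono Set.inter_subset_left).prodMk (hΨ.mono Set.inter_subset_right))
  · rintro k ⟨h1, h2⟩
    exact congrArg₂ (fun a b => B (a, b)) (h k h1) (h' k h2)

theorem SmoothFun.mul {Γ : Subgroup (Grp F r)} {u v : Quo Γ → ℂ} (hu : SmoothFun u)
    (hv : SmoothFun v) : SmoothFun fun x => u x * v x :=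
  hu.comp₂ hv (B := fun p => p.1 * p.2) (contDiff_fst.mul contDiff_snd)

theorem SmoothFun.sub {Γ : Subgroup (Grp F r)} {u v : Quo Γ → ℂ} (hu : SmoothFun u)
    (hv : SmoothFun v) : SmoothFun (u - v) :=
  hu.comp₂ hv (B := fun p => p.1 - p.2) (contDiff_fst.sub contDiff_snd)

theorem SmoothFun.conj {Γ : Subgroup (Grp F r)} {u : Quo Γ → ℂ} (hu : SmoothFun u) :
    SmoothFun fun x => (starRingEnd ℂ) (u x) :=
  hu.comp₂ hu (B := fun p => (starRingEnd ℂ) p.1)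
    (Complex.conjCLE.contDiff.comp contDiff_fst)

variable [StarModule ℝ F] [FiniteDimensional ℝ F]

theorem hasDerivAt_mul_expGrp (g : Grp F r) (Y : lieAlg F r) :
    HasDerivAt (fun s : ℝ => fun i j => mat (g * expGrp (s • Y)) i j)
      (fun i j => (mat g * Y.val) i j) 0 := by
  have : CompleteSpace F := FiniteDimensional.complete ℝ F
  rw [hasDerivAt_pi]
  intro i
  rw [hasDerivAt_pi]
  intro j
  let _ : NormedRing (Matrix (Fin (r + 1)) (Fin (r + 1)) F) := Matrix.linftyOpNormedRing
  let _ : NormedAlgebra ℝ (Matrix (Fin (r + 1)) (Fin (r + 1)) F) := Matrix.linftyOpNormedAlgebra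
  have h := hasDerivAt_exp_smul_const (𝕂 := ℝ) Y.val 0
  rw [zero_smul, NormedSpace.exp_zero, one_mul] at h
  let ℓ : Matrix (Fin (r + 1)) (Fin (r + 1)) F →ₗ[ℝ] F :=
    { toFun := fun A => (mat g * A) i j
      map_add' := fun A B => by rw [Matrix.mul_add, Matrix.add_apply]
      map_smul' := fun c A => by rw [Matrix.mul_smul, Matrix.smul_apply]; rfl }
  exact (LinearMap.toContinuousLinearMap ℓ).hasFDerivAt.comp_hasDerivAt 0 h

/-- The derivative of one local extension to matrices serves all directions `Y` at once; this is the
source of linearity in `Y`. -/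
theorem SmoothFun.exists_differential {Γ : Subgroup (Grp F r)} {u : Quo Γ → ℂ} (hu : SmoothFun u)
    (g : Grp F r) : ∃ L : (Fin (r + 1) → Fin (r + 1) → F) →L[ℝ] ℂ, ∀ Y : lieAlg F r,
      HasDerivAt (fun s : ℝ => u ((Quo.mk Γ g).rmul (expGrp (s • Y))))
        (L fun i j => (mat g * Y.val) i j) 0 := by
  obtain ⟨U, Φ, hU, hg, hΦ, h⟩ := hu g
  refine ⟨fderiv ℝ Φ (fun i j => mat g i j), fun Y => ?_⟩
  have hd := hasDerivAt_mul_expGrp g Y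
  have h0 : (fun i j => mat (g * expGrp ((0 : ℝ) • Y)) i j) = fun i j => mat g i j := by
    rw [zero_smul, expGrp_zero, mul_one]
  have hΦd : HasFDerivAt Φ (fderiv ℝ Φ (fun i j => mat g i j))
      (fun i j => mat (g * expGrp ((0 : ℝ) • Y)) i j) := by
    rw [h0]
    exact ((hΦ.contDiffAt (hU.mem_nhds hg)).differentiableAt (by simp)).hasFDerivAt
  refine (hΦd.comp_hasDerivAt 0 hd).congr_of_eventuallyEq ?_
  have hmem : ∀ᶠ s : ℝ in 𝓝 0, (fun i j => mat (g * expGrp (s • Y)) i j) ∈ U :=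
    hd.continuousAt.preimage_mem_nhds (hU.mem_nhds (by rwa [h0]))
  filter_upwards [hmem] with s hs
  exact h _ hs

theorem SmoothFun.hasDerivAt_zero {Γ : Subgroup (Grp F r)} {u : Quo Γ → ℂ} (hu : SmoothFun u)
    (x : Quo Γ) (Y : lieAlg F r) :
    HasDerivAt (fun s : ℝ => u (x.rmul (expGrp (s • Y)))) (lieDeriv Y u x) 0 := by
  obtain ⟨g, rfl⟩ := Quo.mk_surjective Γ x
  obtain ⟨L, hL⟩ := hu.exists_differential g
  exact (hL Y).differentiableAt.hasDerivAt

theorem SmoothFun.hasDerivAt {Γ : Subgroup (Grp F r)} {u : Quo Γ → ℂ} (hu : SmoothFun u)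
    (x : Quo Γ) (Y : lieAlg F r) (s : ℝ) :
    HasDerivAt (fun s : ℝ => u (x.rmul (expGrp (s • Y))))
      (lieDeriv Y u (x.rmul (expGrp (s • Y)))) s := by
  have h := hu.hasDerivAt_zero (x.rmul (expGrp (s • Y))) Y
  rw [← sub_self s] at h
  refine (h.comp_sub_const s s).congr_of_eventuallyEq (Eventually.of_forall fun s' => ?_)
  simp only [Quo.rmul_rmul, ← expGrp_smul_add, add_sub_cancel]

/-- The differential of a smooth function at a point, as a linear form on the Lie algebra. -/
theorem SmoothFun.exists_linearMap {Γ : Subgroup (Grp F r)} {u : Quo Γ → ℂ} (hu : SmoothFun u)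
    (x : Quo Γ) : ∃ ℓ : lieAlg F r →ₗ[ℝ] ℂ, ∀ Y, ℓ Y = lieDeriv Y u x := by
  obtain ⟨g, rfl⟩ := Quo.mk_surjective Γ x
  obtain ⟨L, hL⟩ := hu.exists_differential g
  refine ⟨{ toFun := fun Y => L fun i j => (mat g * Y.val) i j
            map_add' := fun Y Z => ?_
            map_smul' := fun c Y => ?_ }, fun Y => ?_⟩
  · rw [← map_add]
    congr 1
    ext i j
    simp [Matrix.mul_add]
  · rw [RingHom.id_apply, ← map_smul]
    congr 1
    ext i j
    simp
  · exact (hL Y).unique (hu.hasDerivAt_zero _ Y)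

/-- If `Φ` represents `u` near a point, then `A ↦ dΦ_A(AY)` represents `Yu` on the same open set. -/
theorem SmoothFun.lieDeriv {Γ : Subgroup (Grp F r)} {u : Quo Γ → ℂ} (hu : SmoothFun u)
    (Y : lieAlg F r) : SmoothFun (lieDeriv Y u) := by
  intro g
  obtain ⟨U, Φ, hU, hg, hΦ, h⟩ := hu g
  refine ⟨U, fun A => fderiv ℝ Φ A (fun i j => ∑ k, A i k * Y.val k j), hU, hg, ?_, ?_⟩
  · refine (hΦ.fderiv_of_isOpen hU (m := ∞) le_rfl).clm_apply ?_
    have : ContDiff ℝ ∞ fun A : Fin (r + 1) → Fin (r + 1) → F =>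
        (fun i j => ∑ k, A i k * Y.val k j) := by fun_prop
    exact this.contDiffOn
  · intro k hk
    have hd := hasDerivAt_mul_expGrp k Y
    have h0 : (fun i j => mat (k * expGrp ((0 : ℝ) • Y)) i j) = fun i j => mat k i j := by
      rw [zero_smul, expGrp_zero, mul_one]
    have hΦd : HasFDerivAt Φ (fderiv ℝ Φ (fun i j => mat k i j))
        (fun i j => mat (k * expGrp ((0 : ℝ) • Y)) i j) := by
      rw [h0]
      exact ((hΦ.contDiffAt (hU.mem_nhds hk)).differentiableAt (by simp)).hasFDerivAt
    refine (hu.hasDerivAt_zero (Quo.mk Γ k) Y).unique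
      ((hΦd.comp_hasDerivAt 0 hd).congr_of_eventuallyEq ?_)
    have hmem : ∀ᶠ s : ℝ in 𝓝 0, (fun i j => mat (k * expGrp (s • Y)) i j) ∈ U :=
      hd.continuousAt.preimage_mem_nhds (hU.mem_nhds (by rwa [h0]))
    filter_upwards [hmem] with s hs
    exact h _ hs

theorem lieDeriv_mul {Γ : Subgroup (Grp F r)} {u v : Quo Γ → ℂ} (hu : SmoothFun u)
    (hv : SmoothFun v) (Y : lieAlg F r) (x : Quo Γ) :
    lieDeriv Y (fun x => u x * v x) x = lieDeriv Y u x * v x + u x * lieDeriv Y v x := by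
  have h := (hu.hasDerivAt_zero x Y).mul (hv.hasDerivAt_zero x Y)
  rw [zero_smul, expGrp_zero, Quo.rmul_one] at h
  exact ((hu.mul hv).hasDerivAt_zero x Y).unique h

theorem lieDeriv_conj {Γ : Subgroup (Grp F r)} {u : Quo Γ → ℂ} (hu : SmoothFun u)
    (Y : lieAlg F r) (x : Quo Γ) :
    lieDeriv Y (fun x => (starRingEnd ℂ) (u x)) x = (starRingEnd ℂ) (lieDeriv Y u x) :=
  (hu.conj.hasDerivAt_zero x Y).unique
    (Complex.conjCLE.hasFDerivAt.comp_hasDerivAt 0 (hu.hasDerivAt_zero x Y))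

theorem continuous_expGrp_smul (Y : lieAlg F r) : Continuous fun s : ℝ => expGrp (s • Y) := by
  have : CompleteSpace F := FiniteDimensional.complete ℝ F
  rw [isInducing_mat.continuous_iff]
  let _ : NormedRing (Matrix (Fin (r + 1)) (Fin (r + 1)) F) := Matrix.linftyOpNormedRing
  let _ : NormedAlgebra ℝ (Matrix (Fin (r + 1)) (Fin (r + 1)) F) := Matrix.linftyOpNormedAlgebra
  exact continuous_iff_continuousAt.2 fun s =>
    (hasDerivAt_exp_smul_const (𝕂 := ℝ) Y.val s).continuousAt

theorem lieDeriv_eq_zero_of_notMem_tsupport {Γ : Subgroup (Grp F r)} {u : Quo Γ → ℂ}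
    (Y : lieAlg F r) {x : Quo Γ} (hx : x ∉ tsupport u) : lieDeriv Y u x = 0 := by
  have hcont : Continuous fun s : ℝ => x.rmul (expGrp (s • Y)) :=
    (Quo.continuous_rmul Γ).comp (continuous_const.prodMk (continuous_expGrp_smul Y))
  have hmem : (tsupport u)ᶜ ∈ 𝓝 (x.rmul (expGrp ((0 : ℝ) • Y))) := by
    rw [zero_smul, expGrp_zero, Quo.rmul_one]
    exact (isClosed_tsupport u).isOpen_compl.mem_nhds hx
  have h : (fun s : ℝ => u (x.rmul (expGrp (s • Y)))) =ᶠ[𝓝 0] fun _ => 0 := by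
    filter_upwards [hcont.continuousAt.preimage_mem_nhds hmem] with s hs
    exact image_eq_zero_of_notMem_tsupport hs
  rw [RankOne.lieDeriv, h.deriv_eq, deriv_const]

theorem HasCompactSupport.lieDeriv {Γ : Subgroup (Grp F r)} {u : Quo Γ → ℂ}
    (hu : HasCompactSupport u) (Y : lieAlg F r) : HasCompactSupport (lieDeriv Y u) :=
  hu.mono' fun _ hx => by
    by_contra h
    exact hx (lieDeriv_eq_zero_of_notMem_tsupport Y h)

/-- Skew-Hermitian elements exponentiate into `K`. -/
theorem lieDeriv_eq_zero_of_skew {Γ : Subgroup (Grp F r)} {u : Quo Γ → ℂ} (hu : KInvariant u)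
    {Z : lieAlg F r} (hZ : (Z.val)ᴴ = -Z.val) (x : Quo Γ) : lieDeriv Z u x = 0 := by
  have : CompleteSpace F := FiniteDimensional.complete ℝ F
  have hk : ∀ s : ℝ, IsMaxCompact (expGrp (s • Z)) := fun s => by
    change (mat (expGrp (s • Z)))ᴴ * mat (expGrp (s • Z)) = 1
    let _ : NormedAlgebra ℚ F := NormedAlgebra.restrictScalars ℚ ℝ F
    have h1 : ((s • Z : lieAlg F r).val)ᴴ = -(s • Z : lieAlg F r).val := by
      rw [Submodule.coe_smul, Matrix.conjTranspose_smul, star_trivial, hZ, smul_neg]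
    rw [mat_expGrp, ← Matrix.exp_conjTranspose, h1,
      ← Matrix.exp_add_of_commute _ _ (Commute.neg_left (Commute.refl (s • Z : lieAlg F r).val)), neg_add_cancel,
      NormedSpace.exp_zero]
  have h : (fun s : ℝ => u (x.rmul (expGrp (s • Z)))) = fun _ => u x :=
    funext fun s => hu x _ (hk s)
  rw [RankOne.lieDeriv, h, deriv_const]

/-! ### Integration by parts -/

/-- By invariance of `ν` the integral of `v(x exp(sY))` does not depend on `s`; differentiate under
the integral sign at `s = 0`. -/
theorem integral_lieDeriv_eq_zero {Γ : Subgroup (Grp F r)} {ν : Measure (Quo Γ)}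
    (hν : IsInvariantMeasure ν) {v : Quo Γ → ℂ} (hv : SmoothFun v) (hc : HasCompactSupport v)
    (Y : lieAlg F r) : ∫ x, lieDeriv Y v x ∂ν = 0 := by
  have : IsFiniteMeasureOnCompacts ν := ⟨fun K hK => hν.finite_of_isCompact K hK⟩
  have hcr : ∀ g : Grp F r, Continuous fun x : Quo Γ => x.rmul g := fun g =>
    (Quo.continuous_rmul Γ).comp (continuous_id.prodMk continuous_const)
  have hconst : ∀ s : ℝ, ∫ x, v (x.rmul (expGrp (s • Y))) ∂ν = ∫ x, v x ∂ν := fun s => by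
    conv_rhs => rw [← hν.map_rmul (expGrp (s • Y))]
    rw [integral_map (hcr _).measurable.aemeasurable
      hv.continuous.aestronglyMeasurable]
  -- All points that the flow of `Y` brings into the support of `v` within time `1`: a compact set
  -- carrying the dominating function.
  let E := (fun p : Quo Γ × ℝ => p.1.rmul (expGrp (p.2 • Y))) ''
    (tsupport v ×ˢ Set.Icc (-1 : ℝ) 1)
  have hE : IsCompact E := by
    refine (hc.isCompact.prod isCompact_Icc).image ?_
    exact (Quo.continuous_rmul Γ).comp
      (continuous_fst.prodMk ((continuous_expGrp_smul Y).comp continuous_snd))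
  have hw := hv.lieDeriv Y
  have hwc := HasCompactSupport.lieDeriv hc Y
  obtain ⟨B, hB⟩ := hwc.exists_bound_of_continuous hw.continuous
  -- No separation property of `Γ\G` is used, so `E` might not be measurable; its measurable hull
  -- has the same finite measure.
  let E' := toMeasurable ν E
  have hbound : ∀ x, ∀ s ∈ Metric.ball (0 : ℝ) 1,
      ‖lieDeriv Y v (x.rmul (expGrp (s • Y)))‖ ≤ E'.indicator (fun _ => B) x := by
    intro x s hs
    by_cases hx : x.rmul (expGrp (s • Y)) ∈ tsupport v
    · have hs' : |s| < 1 := by simpa using hs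
      have hxE : x ∈ E := by
        refine ⟨(x.rmul (expGrp (s • Y)), -s), ⟨hx, ?_⟩, ?_⟩
        · rw [abs_lt] at hs'
          constructor <;> simp <;> linarith
        · change (x.rmul (expGrp (s • Y))).rmul (expGrp (-s • Y)) = x
          rw [Quo.rmul_rmul, ← expGrp_smul_add, add_neg_cancel, zero_smul, expGrp_zero,
            Quo.rmul_one]
      rw [Set.indicator_of_mem (subset_toMeasurable ν E hxE)]
      exact hB _
    · rw [lieDeriv_eq_zero_of_notMem_tsupport Y hx, norm_zero]
      exact Set.indicator_nonneg (fun _ _ => (norm_nonneg _).trans (hB x)) x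
  have hint : Integrable (E'.indicator fun _ => B) ν := by
    refine (integrable_indicator_iff (measurableSet_toMeasurable ν E)).2 ?_
    refine integrableOn_const ?_
    rw [measure_toMeasurable]
    exact (hν.finite_of_isCompact E hE).ne
  have h := (hasDerivAt_integral_of_dominated_loc_of_deriv_le (μ := ν)
    (F := fun (s : ℝ) x => v (x.rmul (expGrp (s • Y))))
    (F' := fun (s : ℝ) x => lieDeriv Y v (x.rmul (expGrp (s • Y))))
    (x₀ := 0) (Metric.ball_mem_nhds (0 : ℝ) one_pos)
    (Eventually.of_forall fun s => (hv.continuous.comp (hcr _)).aestronglyMeasurable)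
    ?_ ((hw.continuous.comp (hcr _)).aestronglyMeasurable)
    (Eventually.of_forall hbound) hint
    (Eventually.of_forall fun x s _ => hv.hasDerivAt x Y s)).2
  · simp only [hconst, zero_smul, expGrp_zero, Quo.rmul_one] at h
    exact h.unique (hasDerivAt_const 0 _)
  · simp only [zero_smul, expGrp_zero, Quo.rmul_one]
    exact hv.continuous.integrable_of_hasCompactSupport hc

end Calculus

/-! ### The Dirichlet form, Green's formula and multiplication operators. -/

section Energy

variable {F : Type} [NormedRing F] [StarRing F] [NormedAlgebra ℝ F] [ContinuousStar F] {r : ℕ}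
  [StarModule ℝ F] [FiniteDimensional ℝ F] [Scalars F]

variable (F r) in
/-- The basis of the Lie algebra used in the definition of the Casimir operator. -/
abbrev lieBasis := Module.finBasis ℝ (lieAlg F r)

variable (F r) in
/-- The basis dual to `lieBasis` for the trace form. -/
abbrev lieDual := (traceForm (F := F) (r := r)).dualBasis traceForm_nondegenerate (lieBasis F r)

/-- The quadratic form on covectors dual to the trace form. -/
def energy (ℓ : lieAlg F r →ₗ[ℝ] ℂ) : ℝ :=
  ∑ i, (ℓ (lieDual F r i) * (starRingEnd ℂ) (ℓ (lieBasis F r i))).re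

/-- Write `ℓ = B(A, ·)` for the trace form `B`; the sum is then `ℓ(A)`. Since `A - A*` is
skew-Hermitian, `ℓ(A) = ℓ(A*) = Re tr(A A*)`, a sum of squares. -/
theorem sum_dual_mul_nonneg (ℓ : lieAlg F r →ₗ[ℝ] ℝ)
    (hℓ : ∀ Z : lieAlg F r, (Z.val)ᴴ = -Z.val → ℓ Z = 0) :
    0 ≤ ∑ i, ℓ (lieDual F r i) * ℓ (lieBasis F r i) := by
  let A : lieAlg F r := ∑ i, ℓ (lieBasis F r i) • lieDual F r i
  have hA : ∀ Y, traceForm A Y = ℓ Y := fun Y => by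
    have h : traceForm A = ℓ := by
      refine (lieBasis F r).ext fun j => ?_
      simp [A, LinearMap.BilinForm.apply_dualBasis_left]
    rw [h]
  have hsum : ∑ i, ℓ (lieDual F r i) * ℓ (lieBasis F r i) = ℓ A := by
    simp only [A, map_sum, map_smul, smul_eq_mul, mul_comm]
  let A' : lieAlg F r := ⟨A.valᴴ, conjTranspose_mem_lieAlg A.2⟩
  have hAA' : ℓ A = ℓ A' := by
    rw [← sub_eq_zero, ← map_sub]
    refine hℓ _ ?_
    rw [Submodule.coe_sub, Matrix.conjTranspose_sub, Matrix.conjTranspose_conjTranspose, neg_sub]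
  rw [hsum, hAA', ← hA]
  change 0 ≤ Scalars.re (Matrix.trace (A.val * A.valᴴ))
  rw [re_trace_mul_conjTranspose]
  positivity

theorem energy_nonneg (ℓ : lieAlg F r →ₗ[ℝ] ℂ)
    (hℓ : ∀ Z : lieAlg F r, (Z.val)ᴴ = -Z.val → ℓ Z = 0) : 0 ≤ energy ℓ := by
  have h1 := sum_dual_mul_nonneg (Complex.reLm ∘ₗ ℓ) fun Z hZ => by simp [hℓ Z hZ]
  have h2 := sum_dual_mul_nonneg (Complex.imLm ∘ₗ ℓ) fun Z hZ => by simp [hℓ Z hZ]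
  refine (add_nonneg h1 h2).trans_eq ?_
  rw [energy, ← Finset.sum_add_distrib]
  refine Finset.sum_congr rfl fun i _ => ?_
  simp [Complex.mul_re]

theorem energy_smul (c : ℂ) (ℓ : lieAlg F r →ₗ[ℝ] ℂ) : energy (c • ℓ) = ‖c‖ ^ 2 * energy ℓ := by
  rw [energy, energy, Finset.mul_sum]
  refine Finset.sum_congr rfl fun i _ => ?_
  rw [← Complex.normSq_eq_norm_sq, Complex.normSq_apply]
  simp only [LinearMap.smul_apply, smul_eq_mul, Complex.mul_re, Complex.mul_im, Complex.conj_re,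
    Complex.conj_im]
  ring

theorem energy_parallelogram (ℓ ℓ' : lieAlg F r →ₗ[ℝ] ℂ) :
    energy (ℓ + ℓ') + energy (ℓ - ℓ') = 2 * energy ℓ + 2 * energy ℓ' := by
  simp only [energy, Finset.mul_sum, ← Finset.sum_add_distrib]
  refine Finset.sum_congr rfl fun i _ => ?_
  simp only [LinearMap.add_apply, LinearMap.sub_apply, Complex.mul_re, Complex.add_re,
    Complex.add_im, Complex.sub_re, Complex.sub_im, Complex.conj_re, Complex.conj_im]
  ring

/-- The sum of the norms of the entries of a Lie algebra element. -/
def size (Y : lieAlg F r) : ℝ := ∑ i, ∑ j, ‖Y.val i j‖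

theorem size_nonneg (Y : lieAlg F r) : 0 ≤ size Y := by
  unfold size
  positivity

/-- A crude bound, but its constant involves only the fixed basis and its dual, hence only `G`. -/
theorem energy_le (ℓ : lieAlg F r →ₗ[ℝ] ℂ) {M : ℝ} (hM : 0 ≤ M) (hℓ : ∀ Y, ‖ℓ Y‖ ≤ M * size Y) :
    energy ℓ ≤ M ^ 2 * ∑ i, size (lieDual F r i) * size (lieBasis F r i) := by
  rw [energy, Finset.mul_sum]
  refine Finset.sum_le_sum fun i _ => (Complex.re_le_norm _).trans ?_
  rw [norm_mul, RCLike.norm_conj]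
  calc _ ≤ (M * size (lieDual F r i)) * (M * size (lieBasis F r i)) := by
        have := size_nonneg (lieDual F r i)
        gcongr <;> exact hℓ _
    _ = _ := by ring

/-- The differential of a smooth function at a point. -/
def differential {Γ : Subgroup (Grp F r)} {u : Quo Γ → ℂ} (hu : SmoothFun u) (x : Quo Γ) :
    lieAlg F r →ₗ[ℝ] ℂ := (hu.exists_linearMap x).choose

theorem differential_apply {Γ : Subgroup (Grp F r)} {u : Quo Γ → ℂ} (hu : SmoothFun u)
    (x : Quo Γ) (Y : lieAlg F r) : differential hu x Y = lieDeriv Y u x :=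
  (hu.exists_linearMap x).choose_spec Y

theorem differential_mul {Γ : Subgroup (Grp F r)} {u v : Quo Γ → ℂ} (hu : SmoothFun u)
    (hv : SmoothFun v) (x : Quo Γ) :
    differential (hu.mul hv) x = u x • differential hv x + v x • differential hu x := by
  ext Y
  simp only [LinearMap.add_apply, LinearMap.smul_apply, differential_apply, smul_eq_mul,
    lieDeriv_mul hu hv]
  ring

theorem energy_differential_nonneg {Γ : Subgroup (Grp F r)} {u : Quo Γ → ℂ} (hu : SmoothFun u)
    (hk : KInvariant u) (x : Quo Γ) : 0 ≤ energy (differential hu x) :=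
  energy_nonneg _ fun Z hZ => by rw [differential_apply, lieDeriv_eq_zero_of_skew hk hZ]

theorem integrable_energyDensity {Γ : Subgroup (Grp F r)} {ν : Measure (Quo Γ)}
    (hν : IsInvariantMeasure ν) {u : Quo Γ → ℂ} (hu : SmoothFun u) (hc : HasCompactSupport u) :
    Integrable (fun x => u x * (starRingEnd ℂ) (u x) + 2 * ∑ i, lieDeriv (lieDual F r i) u x *
      (starRingEnd ℂ) (lieDeriv (lieBasis F r i) u x)) ν := by
  have : IsFiniteMeasureOnCompacts ν := ⟨fun K hK => hν.finite_of_isCompact K hK⟩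
  refine Integrable.add ?_ (Integrable.const_mul (integrable_finsetSum _ fun i _ => ?_) _)
  · exact (hu.mul hu.conj).continuous.integrable_of_hasCompactSupport hc.mul_right
  · exact ((hu.lieDeriv _).mul (hu.lieDeriv _).conj).continuous.integrable_of_hasCompactSupport
      (HasCompactSupport.lieDeriv hc _).mul_right

theorem energyDensity_re {Γ : Subgroup (Grp F r)} {u : Quo Γ → ℂ} (hu : SmoothFun u) (x : Quo Γ) :
    (u x * (starRingEnd ℂ) (u x) + 2 * ∑ i, lieDeriv (lieDual F r i) u x *
      (starRingEnd ℂ) (lieDeriv (lieBasis F r i) u x)).re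
      = ‖u x‖ ^ 2 + 2 * energy (differential hu x) := by
  rw [Complex.mul_conj, Complex.add_re, Complex.ofReal_re, Complex.normSq_eq_norm_sq, energy]
  simp only [differential_apply]
  rw [← Complex.re_sum, Complex.mul_re]
  simp

theorem integrable_norm_sq_add_energy {Γ : Subgroup (Grp F r)} {ν : Measure (Quo Γ)}
    (hν : IsInvariantMeasure ν) {u : Quo Γ → ℂ} (hu : SmoothFun u) (hc : HasCompactSupport u) :
    Integrable (fun x => ‖u x‖ ^ 2 + 2 * energy (differential hu x)) ν := by
  simp only [← energyDensity_re]
  exact (integrable_energyDensity hν hu hc).re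

/-- Green's formula: the `H¹`-norm of a test function is its Dirichlet norm. -/
theorem testNorm_eq {Γ : Subgroup (Grp F r)} {ν : Measure (Quo Γ)}
    (hν : IsInvariantMeasure ν) {u : Quo Γ → ℂ} (hu : SmoothFun u) (hc : HasCompactSupport u) :
    testNorm ν u = Real.sqrt (∫ x, ‖u x‖ ^ 2 + 2 * energy (differential hu x) ∂ν) := by
  have : IsFiniteMeasureOnCompacts ν := ⟨fun K hK => hν.finite_of_isCompact K hK⟩
  -- The Leibniz rule for `Y (Y'u · ū)` writes the integrand as the energy density minus a sum of
  -- Lie derivatives, which integrate to zero.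
  have hpt : ∀ x, (u x - laplacian u x) * (starRingEnd ℂ) (u x)
      = (u x * (starRingEnd ℂ) (u x) + 2 * ∑ i, lieDeriv (lieDual F r i) u x *
          (starRingEnd ℂ) (lieDeriv (lieBasis F r i) u x))
        - 2 * ∑ i, lieDeriv (lieBasis F r i)
          (fun x => lieDeriv (lieDual F r i) u x * (starRingEnd ℂ) (u x)) x := by
    intro x
    have h1 : ∀ i, lieDeriv (lieBasis F r i)
        (fun x => lieDeriv (lieDual F r i) u x * (starRingEnd ℂ) (u x)) x
        = lieDeriv (lieBasis F r i) (lieDeriv (lieDual F r i) u) x * (starRingEnd ℂ) (u x)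
          + lieDeriv (lieDual F r i) u x *
            (starRingEnd ℂ) (lieDeriv (lieBasis F r i) u x) := fun i => by
      rw [lieDeriv_mul (hu.lieDeriv _) hu.conj, lieDeriv_conj hu]
    simp only [h1, Finset.sum_add_distrib, laplacian, casimir, ← Finset.sum_mul]
    ring
  have hs : ∀ i, SmoothFun fun x => lieDeriv (lieDual F r i) u x * (starRingEnd ℂ) (u x) :=
    fun i => (hu.lieDeriv _).mul hu.conj
  have hcs : ∀ i, HasCompactSupport
      fun x => lieDeriv (lieDual F r i) u x * (starRingEnd ℂ) (u x) :=
    fun i => (HasCompactSupport.lieDeriv hc _).mul_right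
  have hint : ∀ i, Integrable (lieDeriv (lieBasis F r i)
      (fun x => lieDeriv (lieDual F r i) u x * (starRingEnd ℂ) (u x))) ν := fun i =>
    ((hs i).lieDeriv _).continuous.integrable_of_hasCompactSupport
      (HasCompactSupport.lieDeriv (hcs i) _)
  rw [testNorm]
  congr 1
  simp only [hpt, ← energyDensity_re]
  rw [integral_sub (integrable_energyDensity hν hu hc)
    ((integrable_finsetSum _ fun i _ => hint i).const_mul 2), integral_const_mul,
    integral_finsetSum _ fun i _ => hint i]
  simp only [integral_lieDeriv_eq_zero hν (hs _) (hcs _), Finset.sum_const_zero, mul_zero,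
    sub_zero]
  exact (integral_re (integrable_energyDensity hν hu hc)).symm

theorem isTestFun_sub {Γ : Subgroup (Grp F r)} {u v : Quo Γ → ℂ} (hu : IsTestFun u)
    (hv : IsTestFun v) : IsTestFun (u - v) :=
  ⟨hu.1.sub hv.1, hu.2.1.sub hv.2.1, fun x k hk => by
    rw [Pi.sub_apply, Pi.sub_apply, hu.2.2 x k hk, hv.2.2 x k hk]⟩

theorem isTestFun_mul {Γ : Subgroup (Grp F r)} {ψ u : Quo Γ → ℂ} (hψ : SmoothFun ψ)
    (hk : KInvariant ψ) (hu : IsTestFun u) : IsTestFun fun x => ψ x * u x :=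
  ⟨hψ.mul hu.1, hu.2.1.mul_left, fun x k h => by
    change ψ (x.rmul k) * u (x.rmul k) = ψ x * u x
    rw [hk x k h, hu.2.2 x k h]⟩

variable (F r) in
/-- The norm of the multiplication by a smooth function bounded by `1` with gradient bounded
by `M`. -/
def multiplierBound (M : ℝ) : ℝ :=
  Real.sqrt (2 + 4 * (M ^ 2 * ∑ i, size (lieDual F r i) * size (lieBasis F r i)))

theorem multiplierBound_pos (M : ℝ) : 0 < multiplierBound F r M := by
  refine Real.sqrt_pos.2 ?_
  have : 0 ≤ ∑ i, size (lieDual F r i) * size (lieBasis F r i) :=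
    Finset.sum_nonneg fun i _ => mul_nonneg (size_nonneg _) (size_nonneg _)
  positivity

/-- Pointwise, `d(ψu) = ψ du + u dψ` and the parallelogram law give `|ψu|² + 2E(d(ψu)) ≤ |u|² +
4E(du) + 4κ|u|²`, where `κ` bounds `E(dψ)`. This is at most `2 + 4κ` times `|u|² + 2E(du)`. -/
theorem testNorm_mul_le {Γ : Subgroup (Grp F r)} {ν : Measure (Quo Γ)}
    (hν : IsInvariantMeasure ν) {ψ : Quo Γ → ℂ} (hψ : SmoothFun ψ) (hk : KInvariant ψ)
    (h1 : ∀ x, ‖ψ x‖ ≤ 1) {M : ℝ} (hM : 0 ≤ M) (hψM : ∀ Y x, ‖lieDeriv Y ψ x‖ ≤ M * size Y)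
    {u : Quo Γ → ℂ} (hu : IsTestFun u) :
    testNorm ν (fun x => ψ x * u x) ≤ multiplierBound F r M * testNorm ν u := by
  set κ := M ^ 2 * ∑ i, size (lieDual F r i) * size (lieBasis F r i) with hκ
  have hκ0 : 0 ≤ κ := mul_nonneg (sq_nonneg _)
    (Finset.sum_nonneg fun i _ => mul_nonneg (size_nonneg _) (size_nonneg _))
  rw [testNorm_eq hν hu.1 hu.2.1,
    testNorm_eq hν (hψ.mul hu.1) (isTestFun_mul hψ hk hu).2.1, multiplierBound,
    ← Real.sqrt_mul (by positivity), ← integral_const_mul]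
  refine Real.sqrt_le_sqrt (integral_mono
    (integrable_norm_sq_add_energy hν (hψ.mul hu.1) (isTestFun_mul hψ hk hu).2.1)
    ((integrable_norm_sq_add_energy hν hu.1 hu.2.1).const_mul _) fun x => ?_)
  change ‖ψ x * u x‖ ^ 2 + 2 * energy (differential (hψ.mul hu.1) x) ≤
    (2 + 4 * κ) * (‖u x‖ ^ 2 + 2 * energy (differential hu.1 x))
  have he0 := energy_differential_nonneg hu.1 hu.2.2 x
  have hp := energy_parallelogram (ψ x • differential hu.1 x) (u x • differential hψ x)
  -- The difference term of the parallelogram law can be dropped: both differentials vanish on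
  -- skew-Hermitian elements, so its energy is nonnegative.
  have hm : 0 ≤ energy (ψ x • differential hu.1 x - u x • differential hψ x) :=
    energy_nonneg _ fun Z hZ => by
      simp [differential_apply, lieDeriv_eq_zero_of_skew hu.2.2 hZ,
        lieDeriv_eq_zero_of_skew hk hZ]
  rw [energy_smul, energy_smul] at hp
  have hle : energy (differential hψ x) ≤ κ :=
    energy_le _ hM fun Y => by rw [differential_apply]; exact hψM Y x
  have hψ1 : ‖ψ x‖ ^ 2 ≤ 1 := pow_le_one₀ (norm_nonneg _) (h1 x)
  rw [differential_mul hψ hu.1, norm_mul, mul_pow]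
  have h2 : ‖u x‖ ^ 2 * energy (differential hψ x) ≤ ‖u x‖ ^ 2 * κ := by gcongr
  have h3 : ‖ψ x‖ ^ 2 * energy (differential hu.1 x) ≤ 1 * energy (differential hu.1 x) := by
    gcongr
  have h4 : ‖ψ x‖ ^ 2 * ‖u x‖ ^ 2 ≤ 1 * ‖u x‖ ^ 2 := by gcongr
  have h5 : 0 ≤ κ * energy (differential hu.1 x) := by positivity
  have h6 : 0 ≤ ‖u x‖ ^ 2 := sq_nonneg _
  linarith

/-! ### Multipliers of `H¹` -/

/-- Multiply an approximating sequence of `f` by `ψ`: the bound on test functions, applied to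
differences, keeps it Cauchy, and `|ψ| ≤ 1` keeps the `L²` convergence. -/
theorem hasH1Norm_mul {Γ : Subgroup (Grp F r)} {ν : Measure (Quo Γ)}
    (hν : IsInvariantMeasure ν) {ψ : Quo Γ → ℂ} (hψ : SmoothFun ψ) (hk : KInvariant ψ)
    (h1 : ∀ x, ‖ψ x‖ ≤ 1) {M : ℝ} (hM : 0 ≤ M) (hψM : ∀ Y x, ‖lieDeriv Y ψ x‖ ≤ M * size Y)
    {f : Quo Γ → ℂ} {a : ℝ} (hf : HasH1Norm ν f a) :
    ∃ b, HasH1Norm ν (fun x => ψ x * f x) b ∧ b ≤ multiplierBound F r M * a := by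
  obtain ⟨hL, hfk, u, hu, hcauchy, hlim, hnorm⟩ := hf
  set C := multiplierBound F r M
  have hC : 0 < C := multiplierBound_pos M
  have hbd : ∀ n, testNorm ν (fun x => ψ x * u n x) ≤ C * testNorm ν (u n) := fun n =>
    testNorm_mul_le hν hψ hk h1 hM hψM (hu n)
  obtain ⟨B, hB⟩ := hnorm.bddAbove_range
  have hmem : ∀ n, testNorm ν (fun x => ψ x * u n x) ∈ Set.Icc 0 (C * B) := fun n =>
    ⟨Real.sqrt_nonneg _, (hbd n).trans (by gcongr; exact hB ⟨n, rfl⟩)⟩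
  -- The norms of the products are bounded, so they converge along a subsequence; this avoids a
  -- triangle inequality for `testNorm`.
  obtain ⟨b, -, θ, hθ, hb⟩ := isCompact_Icc.tendsto_subseq hmem
  refine ⟨b, ⟨?_, ?_, fun n x => ψ x * u (θ n) x, ?_, ?_, ?_, hb⟩, ?_⟩
  · refine hL.of_le (hψ.continuous.aestronglyMeasurable.mul hL.1)
      (Eventually.of_forall fun x => ?_)
    rw [norm_mul]
    exact mul_le_of_le_one_left (norm_nonneg _) (h1 x)
  · intro x k h
    change ψ (x.rmul k) * f (x.rmul k) = ψ x * f x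
    rw [hk x k h, hfk x k h]
  · exact fun n => isTestFun_mul hψ hk (hu _)
  · intro ε hε
    obtain ⟨N, hN⟩ := hcauchy (ε / C) (by positivity)
    refine ⟨N, fun m hm n hn => ?_⟩
    have h := hN (θ m) (hm.trans (hθ.le_apply)) (θ n) (hn.trans (hθ.le_apply))
    have h2 := testNorm_mul_le hν hψ hk h1 hM hψM (isTestFun_sub (hu (θ m)) (hu (θ n)))
    have h3 : ((fun x => ψ x * u (θ m) x) - fun x => ψ x * u (θ n) x)
        = fun x => ψ x * (u (θ m) - u (θ n)) x := by
      funext x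
      simp [mul_sub]
    rw [h3]
    refine h2.trans_lt ?_
    rw [lt_div_iff₀ hC] at h
    rwa [mul_comm]
  · refine tendsto_of_tendsto_of_tendsto_of_le_of_le tendsto_const_nhds
      (hlim.comp hθ.tendsto_atTop) (fun _ => zero_le) fun n => ?_
    refine eLpNorm_mono fun x => ?_
    have : ((fun x => ψ x * u (θ n) x) - fun x => ψ x * f x) x
        = ψ x * (u (θ n) - f) x := by simp [mul_sub]
    rw [this, norm_mul]
    exact mul_le_of_le_one_left (norm_nonneg _) (h1 x)
  · exact le_of_tendsto_of_tendsto' hb ((hnorm.comp hθ.tendsto_atTop).const_mul C)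
      fun n => hbd (θ n)

/-- `h1Norm` is an infimum, and each admissible value for `f` yields one for `ψ f` that is at most
the constant times it. Uniqueness of the value is not needed. -/
theorem h1Norm_mul_le {Γ : Subgroup (Grp F r)} {ν : Measure (Quo Γ)}
    (hν : IsInvariantMeasure ν) {ψ : Quo Γ → ℂ} (hψ : SmoothFun ψ) (hk : KInvariant ψ)
    (h1 : ∀ x, ‖ψ x‖ ≤ 1) {M : ℝ} (hM : 0 ≤ M) (hψM : ∀ Y x, ‖lieDeriv Y ψ x‖ ≤ M * size Y)
    {f : Quo Γ → ℂ} (hf : MemH1 ν f) :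
    MemH1 ν (fun x => ψ x * f x) ∧
      h1Norm ν (fun x => ψ x * f x) ≤ multiplierBound F r M * h1Norm ν f := by
  have hC : 0 < multiplierBound F r M := multiplierBound_pos M
  have key := fun (a : ℝ) (ha : HasH1Norm ν f a) => hasH1Norm_mul hν hψ hk h1 hM hψM ha
  obtain ⟨a, ha⟩ := hf
  obtain ⟨b, hb, -⟩ := key a ha
  refine ⟨⟨b, hb⟩, ?_⟩
  rw [← div_le_iff₀' hC]
  refine le_csInf ⟨a, ha⟩ fun a' ha' => ?_
  obtain ⟨b', hb', hba⟩ := key a' ha'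
  rw [div_le_iff₀' hC]
  have hbdd : BddBelow {a | HasH1Norm ν (fun x => ψ x * f x) a} := by
    refine ⟨0, ?_⟩
    rintro d ⟨-, -, u, -, -, -, hd⟩
    exact ge_of_tendsto' hd fun n => Real.sqrt_nonneg _
  exact (csInf_le hbdd hb').trans hba

end Energy

/-- `φ'` is continuous on `[1,2]` and vanishes beyond `2`. The factor `a` makes the quantity the
logarithmic derivative, invariant under rescaling by `t`. -/
theorem IsSmoothStep.exists_deriv_bound {φ : ℝ → ℝ} (hφ : IsSmoothStep φ) :
    ∃ B : ℝ, 0 ≤ B ∧ ∀ a, 1 < a → |deriv φ a| * a ≤ B := by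
  have hcont : ContinuousOn (fun a => |deriv φ a| * a) (Set.Icc 1 2) := by
    have h := (hφ.contDiffOn.continuousOn_deriv_of_isOpen isOpen_Ioi (by simp)).mono
      (fun a (ha : a ∈ Set.Icc (1 : ℝ) 2) => (zero_lt_one.trans_le ha.1 : (0 : ℝ) < a))
    exact h.abs.mul continuousOn_id
  obtain ⟨B, hB⟩ := isCompact_Icc.exists_bound_of_continuousOn hcont
  refine ⟨B, (norm_nonneg _).trans (hB 1 (by norm_num)), fun a ha => ?_⟩
  by_cases h2 : a ≤ 2
  · exact (Real.le_norm_self _).trans (hB a ⟨ha.le, h2⟩)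
  · push Not at h2
    have h : φ =ᶠ[𝓝 a] fun _ => 1 := by
      filter_upwards [lt_mem_nhds h2] with b hb
      exact hφ.eq_one b hb.le
    rw [h.deriv_eq, deriv_const, abs_zero, zero_mul]
    exact (norm_nonneg _).trans (hB 1 (by norm_num))

/-! ### The cut-off function of the cusp: invariance, smoothness and gradient. -/

section Cusp

variable {F : Type} [NormedRing F] [StarRing F] [NormedAlgebra ℝ F] [ContinuousStar F] {r : ℕ}

open Classical in
/-- The cut-off function of the cusp: `φ(y / t)` at the points of `Γ\G` of height `y > t`. -/
def cuspWeight {Γ : Subgroup (Grp F r)} (φ : ℝ → ℝ) (t : ℝ) : Quo Γ → ℝ := fun x =>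
  if h : ∃ g : Grp F r, Quo.mk Γ g = x ∧ t < height g then φ (height h.choose / t) else 0

theorem cuspTail_eq {Γ : Subgroup (Grp F r)} (φ : ℝ → ℝ) (t : ℝ) (f : Quo Γ → ℂ) :
    cuspTail φ t f = fun x => (cuspWeight φ t x : ℂ) * f x := by
  funext x
  unfold cuspTail cuspWeight
  split_ifs <;> simp

theorem cuspWeight_eq_zero {Γ : Subgroup (Grp F r)} {φ : ℝ → ℝ} {t : ℝ} {g : Grp F r}
    (h : ∀ γ ∈ Γ, height (γ * g) ≤ t) : cuspWeight φ t (Quo.mk Γ g) = 0 := by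
  rw [cuspWeight, dif_neg]
  rintro ⟨g', hg', ht⟩
  obtain ⟨γ, hγ, rfl⟩ := Quo.mk_eq_iff.1 hg'
  exact ht.not_ge (h γ hγ)

/-- The parabolic elements of `Γ` preserve the height, and `t` is at least a separating height. -/
structure SeparatedAt (Γ : Subgroup (Grp F r)) (t : ℝ) : Prop where
  pos : 0 < t
  isParabolic : ∀ γ ∈ Γ, ∀ g : Grp F r, t < height g → t < height (γ * g) → IsParabolic γ
  height_mul : ∀ p ∈ Γ, IsParabolic p → ∀ g, height (p * g) = height g

/-- The chosen representative is irrelevant: any two of height above `t` differ by an element of `Γ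
∩ P`, which preserves the height. -/
theorem cuspWeight_mk {Γ : Subgroup (Grp F r)} {φ : ℝ → ℝ} {t : ℝ} (hΓ : SeparatedAt Γ t)
    {g : Grp F r} (hg : t < height g) : cuspWeight φ t (Quo.mk Γ g) = φ (height g / t) := by
  have h : ∃ g' : Grp F r, Quo.mk Γ g' = Quo.mk Γ g ∧ t < height g' := ⟨g, rfl, hg⟩
  rw [cuspWeight, dif_pos h]
  obtain ⟨h1, h2⟩ := h.choose_spec
  obtain ⟨γ, hγ, hγg⟩ := Quo.mk_eq_iff.1 h1
  rw [← hγg] at h2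
  rw [← hγg, hΓ.height_mul γ hγ (hΓ.isParabolic γ hγ g hg h2)]

theorem cuspWeight_mem_Icc [NormOneClass F] {Γ : Subgroup (Grp F r)} {φ : ℝ → ℝ}
    (hφ : IsSmoothStep φ) {t : ℝ} (ht : 0 < t) (x : Quo Γ) :
    cuspWeight φ t x ∈ Set.Icc (0 : ℝ) 1 := by
  unfold cuspWeight
  split_ifs with h
  · exact hφ.mem_Icc _ (div_pos (height_pos _) ht)
  · simp

theorem kInvariant_cuspWeight [NormOneClass F] [Scalars F] {Γ : Subgroup (Grp F r)} {φ : ℝ → ℝ}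
    {t : ℝ} (hΓ : SeparatedAt Γ t) : KInvariant fun x : Quo Γ => (cuspWeight φ t x : ℂ) := by
  intro x k hk
  obtain ⟨g, rfl⟩ := Quo.mk_surjective Γ x
  rw [Quo.rmul_mk]
  refine congrArg Complex.ofReal ?_
  by_cases h : ∃ γ ∈ Γ, t < height (γ * g)
  · obtain ⟨γ, hγ, ht⟩ := h
    rw [← Quo.mk_mul_left hγ g, ← Quo.mk_mul_left hγ (g * k), ← mul_assoc, cuspWeight_mk hΓ ht,
      cuspWeight_mk hΓ (by rwa [height_mul_isMaxCompact _ hk]), height_mul_isMaxCompact _ hk]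
  · push Not at h
    rw [cuspWeight_eq_zero h, cuspWeight_eq_zero fun γ hγ => ?_]
    rw [← mul_assoc, height_mul_isMaxCompact _ hk]
    exact h γ hγ

variable [StarModule ℝ F] [FiniteDimensional ℝ F] [Scalars F]

theorem contDiff_norm_sq_scalars : ContDiff ℝ ∞ fun x : F => ‖x‖ ^ 2 := by
  simp only [← Scalars.re_mul_star]
  have h1 : ContDiff ℝ ∞ fun x : F => x * star x :=
    contDiff_id.mul (starL' ℝ : F ≃L[ℝ] F).contDiff
  exact (LinearMap.toContinuousLinearMap (Scalars.re (F := F))).contDiff.comp h1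

variable (F) in
/-- A bound for the real part. -/
def reBound : ℝ := ‖LinearMap.toContinuousLinearMap (Scalars.re (F := F))‖

theorem abs_re_le (x : F) : |Scalars.re x| ≤ reBound F * ‖x‖ :=
  (LinearMap.toContinuousLinearMap (Scalars.re (F := F))).le_opNorm x

/-- Along `g exp(sY)` the last row `w` has derivative `wY`, so the derivative of its squared length
is again quadratic in `w`. -/
theorem exists_hasDerivAt_rowSq [NormedStarGroup F] (g : Grp F r) (Y : lieAlg F r) :
    ∃ D : ℝ, HasDerivAt (fun s : ℝ => rowSq (mat (g * expGrp (s • Y)))) D 0 ∧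
      |D| ≤ 2 * reBound F * size Y * rowSq (mat g) := by
  let w : Fin (r + 1) → F := fun j => mat g (Fin.last r) j
  let w' : Fin (r + 1) → F := fun j => (mat g * Y.val) (Fin.last r) j
  have hw : ∀ j, HasDerivAt (fun s : ℝ => mat (g * expGrp (s • Y)) (Fin.last r) j) (w' j) 0 :=
    fun j => hasDerivAt_pi.1 (hasDerivAt_pi.1 (hasDerivAt_mul_expGrp g Y) (Fin.last r)) j
  have h0 : ∀ j, mat (g * expGrp ((0 : ℝ) • Y)) (Fin.last r) j = w j := fun j => by
    rw [zero_smul, expGrp_zero, mul_one]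
  have hsq : ∀ j, HasDerivAt (fun s : ℝ => ‖mat (g * expGrp (s • Y)) (Fin.last r) j‖ ^ 2)
      (Scalars.re (w' j * star (w j) + w j * star (w' j))) 0 := fun j => by
    simp only [← Scalars.re_mul_star]
    have h1 : HasDerivAt (fun s : ℝ => star (mat (g * expGrp (s • Y)) (Fin.last r) j))
        (star (w' j)) 0 :=
      (starL' ℝ : F ≃L[ℝ] F).hasFDerivAt.comp_hasDerivAt 0 (hw j)
    have h2 := (hw j).mul h1
    rw [h0] at h2
    exact (LinearMap.toContinuousLinearMap (Scalars.re (F := F))).hasFDerivAt.comp_hasDerivAt 0 h2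
  refine ⟨_, HasDerivAt.fun_sum fun j _ => hsq j, ?_⟩
  have hR : 0 ≤ reBound F := norm_nonneg _
  set q := Real.sqrt (rowSq (mat g)) with hq
  have hwq : ∀ j, ‖w j‖ ≤ q := fun j => Real.le_sqrt_of_sq_le
    (Finset.single_le_sum (f := fun j => ‖w j‖ ^ 2) (fun _ _ => sq_nonneg _) (Finset.mem_univ j))
  have hq0 : 0 ≤ q := Real.sqrt_nonneg _
  have hqq : q * q = rowSq (mat g) := Real.mul_self_sqrt (rowSq_nonneg _)
  have hw'q : ∀ j, ‖w' j‖ ≤ q * ∑ i, ‖Y.val i j‖ := fun j => by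
    simp only [w', Matrix.mul_apply]
    rw [Finset.mul_sum]
    refine (norm_sum_le _ _).trans (Finset.sum_le_sum fun i _ => (norm_mul_le _ _).trans ?_)
    gcongr
    exact hwq i
  calc _ ≤ ∑ j, |Scalars.re (w' j * star (w j) + w j * star (w' j))| :=
        Finset.abs_sum_le_sum_abs _ _
    _ ≤ ∑ j, 2 * reBound F * (q * q) * ∑ i, ‖Y.val i j‖ := by
      refine Finset.sum_le_sum fun j _ => (abs_re_le _).trans ?_
      have h3 : ‖w' j * star (w j) + w j * star (w' j)‖ ≤ 2 * ((q * ∑ i, ‖Y.val i j‖) * q) := by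
        refine (norm_add_le _ _).trans ?_
        have h4 : ‖w' j‖ * ‖w j‖ ≤ (q * ∑ i, ‖Y.val i j‖) * q := by
          gcongr
          · exact hw'q j
          · exact hwq j
        have h5 := norm_mul_le (w' j) (star (w j))
        have h6 := norm_mul_le (w j) (star (w' j))
        rw [norm_star] at h5 h6
        rw [mul_comm] at h6
        linarith
      calc _ ≤ reBound F * (2 * ((q * ∑ i, ‖Y.val i j‖) * q)) := by gcongr
        _ = _ := by ring
    _ = _ := by
      rw [← Finset.mul_sum, hqq, size, Finset.sum_comm]
      ring

variable [NormOneClass F]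

/-- The logarithmic derivative of the height is bounded on the group. -/
theorem exists_hasDerivAt_height [NormedStarGroup F] (g : Grp F r) (Y : lieAlg F r) :
    ∃ D : ℝ, HasDerivAt (fun s : ℝ => height (g * expGrp (s • Y))) D 0 ∧
      |D| ≤ reBound F * size Y * height g := by
  obtain ⟨D, hD, hDle⟩ := exists_hasDerivAt_rowSq g Y
  have hpos := rowSq_mat_pos g
  have h0 : rowSq (mat (g * expGrp ((0 : ℝ) • Y))) = rowSq (mat g) := by
    rw [zero_smul, expGrp_zero, mul_one]
  have h1 := (hD.sqrt (by rw [h0]; exact hpos.ne')).fun_inv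
    (by rw [h0]; exact (Real.sqrt_pos.2 hpos).ne')
  refine ⟨_, h1, ?_⟩
  rw [h0, height_def]
  set q := Real.sqrt (rowSq (mat g)) with hq
  have hq0 : 0 < q := Real.sqrt_pos.2 hpos
  have hqq : rowSq (mat g) = q ^ 2 := (Real.sq_sqrt hpos.le).symm
  rw [abs_div, abs_neg, abs_div, abs_of_pos (show 0 < 2 * q by positivity),
    abs_of_pos (show 0 < q ^ 2 by positivity), div_div, div_le_iff₀ (by positivity)]
  rw [hqq] at hDle
  refine hDle.trans_eq ?_
  field_simp

theorem contDiffOn_height_comp {φ : ℝ → ℝ} (hφ : IsSmoothStep φ) {t : ℝ} (ht : 0 < t)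
    (γ : Grp F r) {U : Set (Fin (r + 1) → Fin (r + 1) → F)}
    (hU : ∀ A ∈ U, 0 < rowSq (mat γ * Matrix.of A)) :
    ContDiffOn ℝ ∞
      (fun A : Fin (r + 1) → Fin (r + 1) → F =>
        φ ((Real.sqrt (rowSq (mat γ * Matrix.of A)))⁻¹ / t)) U := by
  have h1 : ContDiff ℝ ∞ fun A : Fin (r + 1) → Fin (r + 1) → F =>
      rowSq (mat γ * Matrix.of A) := by
    unfold rowSq
    refine ContDiff.sum fun j _ => contDiff_norm_sq_scalars.comp ?_
    simp only [Matrix.mul_apply, Matrix.of_apply]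
    fun_prop
  have h2 : ContDiffOn ℝ ∞ (fun A : Fin (r + 1) → Fin (r + 1) → F =>
      (Real.sqrt (rowSq (mat γ * Matrix.of A)))⁻¹ / t) U :=
    ((h1.contDiffOn.sqrt fun A hA => (hU A hA).ne').inv
      fun A hA => (Real.sqrt_pos.2 (hU A hA)).ne').div_const t
  exact hφ.contDiffOn.comp h2 fun A hA =>
    div_pos (inv_pos.2 (Real.sqrt_pos.2 (hU A hA))) ht

variable [NormMulClass F] [NormedStarGroup F] [CompositionScalars F]

/-- Near `g`, the weight is the sum of `φ(y(γh)/t)` over finitely many representatives `γ` modulo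
`P`; separation leaves at most one nonzero term at each point. This also covers boundary points of
the horoballs. -/
theorem smoothFun_cuspWeight (hr : 1 ≤ r) {Γ : Subgroup (Grp F r)} {φ : ℝ → ℝ}
    (hφ : IsSmoothStep φ) {t : ℝ} (hΓ : SeparatedAt Γ t) :
    SmoothFun fun x : Quo Γ => (cuspWeight φ t x : ℂ) := by
  intro g
  have ht := hΓ.pos
  -- The squared Hilbert–Schmidt norm of `h⁻¹g` is `r + 1` at `h = g`, so requiring it to be less
  -- than `r + 2 = K²` defines an open neighbourhood of `g`. There `y(γh) > t` forces `y(γg) > t/K`,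
  -- which fixes the height for the finite set `T`.
  set K : ℝ := Real.sqrt (r + 2) with hK
  have hK0 : 0 < K := Real.sqrt_pos.2 (by positivity)
  have hKK : K ^ 2 = r + 2 := Real.sq_sqrt (by positivity)
  obtain ⟨T, hTΓ, hTne, hT⟩ := exists_finset_representatives hr ⟨ht, hΓ.isParabolic⟩ g
    (a := t / K) (by positivity)
  let σ := Equiv.swap 0 (Fin.last r)
  -- The squared norm of `A⁻¹g` with `A⁻¹` written as `S A* S`, which makes sense for every matrix
  -- `A`.
  let N : (Fin (r + 1) → Fin (r + 1) → F) → ℝ := fun A =>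
    ∑ j, ∑ i, ‖∑ k, star (A (σ k) (σ i)) * mat g k j‖ ^ 2
  have hN : Continuous N := by fun_prop
  have hNmat : ∀ h : Grp F r, N (fun i j => mat h i j) = ∑ j, ∑ i, ‖mat (h⁻¹ * g) i j‖ ^ 2 := by
    intro h
    simp only [N, mat_mul, Matrix.mul_apply, mat_inv_apply, σ]
  have hrow : ∀ γ : Grp F r, Continuous fun A : Fin (r + 1) → Fin (r + 1) → F =>
      rowSq (mat γ * Matrix.of A) := by
    intro γ
    simp only [rowSq, Matrix.mul_apply, Matrix.of_apply]
    fun_prop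
  refine ⟨{A | N A < r + 2} ∩ ⋂ γ ∈ T, {A | 0 < rowSq (mat γ * Matrix.of A)},
    fun A => ∑ γ ∈ T, (φ ((Real.sqrt (rowSq (mat γ * Matrix.of A)))⁻¹ / t) : ℂ), ?_, ⟨?_, ?_⟩,
    ?_, ?_⟩
  · exact (isOpen_lt hN continuous_const).inter
      (isOpen_biInter_finset fun γ _ => isOpen_lt continuous_const (hrow γ))
  · change N (fun i j => mat g i j) < r + 2
    rw [hNmat, inv_mul_cancel, mat_one]
    have : ∀ i j : Fin (r + 1), ‖(1 : Matrix (Fin (r + 1)) (Fin (r + 1)) F) i j‖ ^ 2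
        = if i = j then 1 else 0 := fun i j => by
      rw [Matrix.one_apply]
      split_ifs <;> simp
    simp only [this, Finset.sum_ite_eq', Finset.mem_univ, if_true, Finset.sum_const,
      Finset.card_univ, Fintype.card_fin, nsmul_eq_mul, mul_one]
    push_cast
    linarith
  · refine Set.mem_iInter₂.2 fun γ _ => ?_
    exact rowSq_mat_pos (γ * g)
  · refine ContDiffOn.sum fun γ hγ => Complex.ofRealCLM.contDiff.comp_contDiffOn ?_
    exact contDiffOn_height_comp hφ ht γ fun A hA => Set.mem_iInter₂.1 hA.2 γ hγ
  · rintro h ⟨hh, -⟩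
    change (cuspWeight φ t (Quo.mk Γ h) : ℂ) = ∑ γ ∈ T, (φ (height (γ * h) / t) : ℂ)
    rw [← Complex.ofReal_sum]
    congr 1
    have hzero : ∀ γ, height (γ * h) ≤ t → φ (height (γ * h) / t) = 0 := fun γ hγ =>
      hφ.eq_zero _ (div_pos (height_pos _) ht) ((div_le_one ht).2 hγ)
    by_cases hex : ∃ γ ∈ Γ, t < height (γ * h)
    · obtain ⟨γ, hγ, hγt⟩ := hex
      have hlt : t / K < height (γ * g) := by
        rw [lt_height_iff (by positivity)]
        have h1 : mat (γ * g) = mat (γ * h) * mat (h⁻¹ * g) := by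
          rw [← mat_mul]
          congr 1
          group
        have h2 : ∑ j, ∑ i, ‖mat (h⁻¹ * g) i j‖ ^ 2 < K ^ 2 := by
          rw [← hNmat, hKK]
          exact hh
        have h3 := (lt_height_iff ht _).1 hγt
        rw [h1]
        calc _ ≤ _ := rowSq_mul_le _ _
          _ ≤ rowSq (mat (γ * h)) * K ^ 2 := by
            gcongr
            exact rowSq_nonneg _
          _ < (t⁻¹) ^ 2 * K ^ 2 := by gcongr
          _ = _ := by field_simp
      obtain ⟨γ', hγ', hp⟩ := hT γ hγ hlt
      have hγ'h : height (γ' * h) = height (γ * h) := by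
        have := hΓ.height_mul _ (Γ.mul_mem (hTΓ γ' hγ') (Γ.inv_mem hγ)) hp (γ * h)
        rwa [mul_assoc, inv_mul_cancel_left] at this
      rw [Finset.sum_eq_single_of_mem γ' hγ', ← Quo.mk_mul_left (hTΓ γ' hγ') h,
        cuspWeight_mk hΓ (by rwa [hγ'h])]
      intro γ'' hγ'' hne
      refine hzero γ'' (le_of_not_gt fun hgt => hTne γ'' hγ'' γ' hγ' hne ?_)
      refine hΓ.isParabolic _ (Γ.mul_mem (hTΓ _ hγ'') (Γ.inv_mem (hTΓ _ hγ'))) (γ' * h)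
        (by rwa [hγ'h]) ?_
      rwa [mul_assoc, inv_mul_cancel_left]
    · push Not at hex
      rw [cuspWeight_eq_zero hex, Finset.sum_eq_zero fun γ hγ => hzero γ (hex γ (hTΓ γ hγ))]

/-- Above height `t` the derivative is `φ'(y/t)(y/t)` times `Y log y`, and each factor is bounded
independently of `t` and `Γ`. -/
theorem norm_lieDeriv_cuspWeight_le (hr : 1 ≤ r) {Γ : Subgroup (Grp F r)} {φ : ℝ → ℝ}
    (hφ : IsSmoothStep φ) {t : ℝ} (hΓ : SeparatedAt Γ t) {B : ℝ}
    (hB : ∀ a, 1 < a → |deriv φ a| * a ≤ B) (Y : lieAlg F r) (x : Quo Γ) :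
    ‖lieDeriv Y (fun x : Quo Γ => (cuspWeight φ t x : ℂ)) x‖ ≤ B * reBound F * size Y := by
  have ht := hΓ.pos
  obtain ⟨g, rfl⟩ := Quo.mk_surjective Γ x
  have hsm := (smoothFun_cuspWeight hr hφ hΓ).hasDerivAt_zero (Quo.mk Γ g) Y
  by_cases h : ∃ γ ∈ Γ, t < height (γ * g)
  · obtain ⟨γ, hγ, hγt⟩ := h
    rw [← Quo.mk_mul_left hγ g] at hsm ⊢
    generalize γ * g = g at hsm hγt ⊢
    obtain ⟨D, hD, hDle⟩ := exists_hasDerivAt_height g Y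
    have h0 : height (g * expGrp ((0 : ℝ) • Y)) = height g := by
      rw [zero_smul, expGrp_zero, mul_one]
    have h1 : 1 < height g / t := (one_lt_div ht).2 hγt
    have hφd : HasDerivAt φ (deriv φ (height g / t))
        (height (g * expGrp ((0 : ℝ) • Y)) / t) := by
      rw [h0]
      exact ((hφ.contDiffOn.contDiffAt (Ioi_mem_nhds (zero_lt_one.trans h1))).differentiableAt
        (by simp)).hasDerivAt
    have hd := (hφd.comp (0 : ℝ) (hD.div_const t)).ofReal_comp
    have hev : ∀ᶠ s : ℝ in 𝓝 0, t < height (g * expGrp (s • Y)) :=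
      hD.continuousAt.eventually (lt_mem_nhds (hγt.trans_eq h0.symm))
    have hd' := hd.congr_of_eventuallyEq (f₁ := fun s : ℝ =>
      (cuspWeight φ t ((Quo.mk Γ g).rmul (expGrp (s • Y))) : ℂ)) (by
        filter_upwards [hev] with s hs
        rw [Quo.rmul_mk, cuspWeight_mk hΓ hs]
        rfl)
    rw [hsm.unique hd', Complex.norm_real, Real.norm_eq_abs, abs_mul, abs_div, abs_of_pos ht]
    have hsz := size_nonneg Y
    have hR : 0 ≤ reBound F := norm_nonneg _
    calc |deriv φ (height g / t)| * (|D| / t)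
        ≤ |deriv φ (height g / t)| * (reBound F * size Y * height g / t) := by gcongr
      _ = (|deriv φ (height g / t)| * (height g / t)) * (reBound F * size Y) := by ring
      _ ≤ B * (reBound F * size Y) := by
        gcongr
        exact hB _ h1
      _ = _ := by ring
  · push Not at h
    have hre : HasDerivAt (fun s : ℝ => cuspWeight φ t ((Quo.mk Γ g).rmul (expGrp (s • Y))))
        (lieDeriv Y (fun x : Quo Γ => (cuspWeight φ t x : ℂ)) (Quo.mk Γ g)).re 0 :=
      Complex.reCLM.hasFDerivAt.comp_hasDerivAt 0 hsm
    -- Off the open horoballs, boundary included, the weight attains its minimum `0`, so its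
    -- derivative vanishes with no computation.
    have hmin : IsLocalMin
        (fun s : ℝ => cuspWeight φ t ((Quo.mk Γ g).rmul (expGrp (s • Y)))) 0 :=
      Eventually.of_forall fun s => by
        simp only [zero_smul, expGrp_zero, Quo.rmul_one, cuspWeight_eq_zero h]
        exact (cuspWeight_mem_Icc hφ ht _).1
    have h0 := hmin.hasDerivAt_eq_zero hre
    rw [h0] at hre
    rw [hsm.unique hre.ofReal_comp, Complex.ofReal_zero, norm_zero]
    have hB0 : 0 ≤ B := (by positivity : 0 ≤ |deriv φ 2| * 2).trans (hB 2 one_lt_two)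
    have hsz := size_nonneg Y
    have hR : 0 ≤ reBound F := norm_nonneg _
    positivity

theorem tailBound (hr : 1 ≤ r) (hN : NoncompactUnipotent F r) : TailBound F r := by
  intro φ hφ
  obtain ⟨B, hB0, hB⟩ := hφ.exists_deriv_bound
  -- The constant is fixed before `Γ`, `ν`, `c` and `t` appear: it uses only the Lie algebra bases,
  -- the bound for `re`, and the bound for `φ'(a)a`.
  refine ⟨multiplierBound F r (B * reBound F), ?_⟩
  intro Γ hΓ hco ν hν c hc f hf t ht1 hct
  have hsep : SeparatedAt Γ t :=
    { pos := zero_lt_one.trans_le ht1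
      isParabolic := fun γ hγ g h1 h2 => hc.2 γ hγ g (hct.trans_lt h1) (hct.trans_lt h2)
      height_mul := fun p hp hpp g => height_mul_of_cocompact hN hΓ hco hp hpp g }
  rw [cuspTail_eq]
  refine h1Norm_mul_le hν (smoothFun_cuspWeight hr hφ hsep) (kInvariant_cuspWeight hsep)
    (fun x => ?_) (mul_nonneg hB0 (norm_nonneg _))
    (fun Y x => norm_lieDeriv_cuspWeight_le hr hφ hsep hB Y x) hf
  have h := cuspWeight_mem_Icc hφ hsep.pos x
  rw [Complex.norm_real, Real.norm_of_nonneg h.1]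
  exact h.2

end Cusp

end RankOne

end

theorem mainTheorem8 :
    (∀ r : ℕ, 2 ≤ r → RankOne.TailBound ℝ r) ∧
    (∀ r : ℕ, 1 ≤ r → RankOne.TailBound ℂ r) ∧
    (∀ r : ℕ, 1 ≤ r → RankOne.TailBound ℍ[ℝ] r) := by
  refine ⟨fun r hr => ?_, fun r hr => ?_, fun r hr => ?_⟩
  · exact RankOne.tailBound (one_le_two.trans hr) (RankOne.noncompactUnipotent_of_two_le hr)
  · exact RankOne.tailBound hr
      (RankOne.noncompactUnipotent_of_imaginary hr (ι := Complex.I) Complex.conj_I Complex.I_ne_zero)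
  · refine RankOne.tailBound hr
      (RankOne.noncompactUnipotent_of_imaginary hr (ι := ⟨0, 1, 0, 0⟩) ?_ ?_)
    · exact Quaternion.star_eq_neg.2 rfl
    · intro h
      have := congrArg QuaternionAlgebra.imI h
      simp at this
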